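/- Let $G=\mathrm{SL}_3(\mathbb R)$, $\Gamma=\mathrm{SL}_3(\mathbb Z)$, and let $X=G/\Gamma$ be the space of unimodular lattices in $\mathbb R^3$, where $g\Gamma$ corresponds to the lattice $g\mathbb Z^3$. For a function $f:\mathbb R^3\to\mathbb R$ of bounded support let $\widehat f(\Lambda)=\sum_{\lambda\in\Lambda\setminus\{0\}}f(\lambda)$, $\Lambda\in X$, be its Siegel transform, and for $n=(n_1,n_2)$ let $a(n)=\mathrm{diag}(e^{n_1},e^{n_2},e^{-n_1-n_2})$. Let $$G_1=\begin{pmatrix} * & 0 & *\\ * & 1 & *\\ * & 0 & *\end{pmatrix}\cap G,\qquad G_2=\begin{pmatrix} 1 & * & *\\ 0 & * & *\\ 0 & * & *\end{pmatrix}\cap G,$$ let $Y_i=G_i\Gamma\subset X$, and let $\nu_i$ be the $G_i$-invariant probability measure supported on $Y_i$ ($i=1,2$). Let $c\in(0,1)$, $p\in[1,2)$ and $B>0$. There is a constant $C>0$, depending only on $c$, $p$ and $B$, such that for all $\beta\in(0,B]$, all Borel measurable functions $f:\mathbb R^3\to[0,1]$ that vanish outside $[-c,c]^2\times[-\beta,\beta]$,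 all integers $n_1,n_2\ge 0$ and $i=1,2$, the function $\Lambda\mapsto \widehat f(a(n)\Lambda)^p$ is $\nu_i$-integrable on $Y_i$ and $$\int_{Y_i}\widehat f(a(n)\Lambda)^{p}\,d\nu_i(\Lambda)\le C\,\beta^{p/2}.$$ -/

import Mathlib

namespace LatticeSpace

open MeasureTheory Set
open scoped ENNReal MatrixGroups

/-! ### The invariant probability measure on a homogeneous subspace -/

section HomogeneousMeasure

variable {G : Type*} [Group G] [MeasurableSpace G]

/-- The orbit map `H → G ⧸ Γ`, `h ↦ h Γ`, of a subgroup `H` of `G`. -/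
def orbitMap (Γ H : Subgroup G) (h : H) : G ⧸ Γ := ((h : G) : G ⧸ Γ)

/-- The homogeneous subspace `H Γ` of `G ⧸ Γ`. -/
def homSubspace (Γ H : Subgroup G) : Set (G ⧸ Γ) := range (orbitMap Γ H)

/-- Here `G ⧸ Γ` carries the quotient σ-algebra: `A` is measurable iff its preimage in `G` is.
For a closed subgroup of a Polish group this is the Borel σ-algebra of the quotient topology. -/
lemma measurable_orbitMap (Γ H : Subgroup G) : Measurable (orbitMap Γ H) := by
  have h : Measurable (fun g : G => (g : G ⧸ Γ)) := fun s hs => hs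
  exact h.comp measurable_subtype_coe

/-- The mass that a measure `m` on `H` induces on a set `A ⊆ G ⧸ Γ`: the largest `m`-measure of a
measurable set of `H` that the orbit map sends injectively into `A`. If `F ⊆ H` is a measurable
fundamental domain for the right action of a countable group `H ∩ Γ`, and `m` is invariant under
this action, then this is `m (F ∩ {h | h Γ ∈ A})` for measurable `A`. -/
noncomputable def quotientMass (Γ H : Subgroup G) (m : Measure H) (A : Set (G ⧸ Γ)) : ℝ≥0∞ :=
  ⨆ B : {B : Set H // MeasurableSet B ∧ InjOn (orbitMap Γ H) B ∧ B ⊆ orbitMap Γ H ⁻¹' A}, m B.1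

lemma le_quotientMass (Γ H : Subgroup G) (m : Measure H) {A : Set (G ⧸ Γ)} {B : Set H}
    (h1 : MeasurableSet B) (h2 : InjOn (orbitMap Γ H) B) (h3 : B ⊆ orbitMap Γ H ⁻¹' A) :
    m B ≤ quotientMass Γ H m A :=
  le_iSup (fun B : {B : Set H // MeasurableSet B ∧ InjOn (orbitMap Γ H) B ∧
    B ⊆ orbitMap Γ H ⁻¹' A} => m B.1) ⟨B, h1, h2, h3⟩

lemma quotientMass_empty (Γ H : Subgroup G) (m : Measure H) : quotientMass Γ H m ∅ = 0 := by
  refine le_antisymm (iSup_le ?_) zero_le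
  rintro ⟨B, -, -, hB⟩
  have : B = ∅ := by simpa using hB
  simp [this]

lemma quotientMass_iUnion (Γ H : Subgroup G) (m : Measure H) {A : ℕ → Set (G ⧸ Γ)}
    (hA : ∀ i, MeasurableSet (A i)) (hd : Pairwise (Function.onFun Disjoint A)) :
    quotientMass Γ H m (⋃ i, A i) = ∑' i, quotientMass Γ H m (A i) := by
  apply le_antisymm
  · refine iSup_le ?_
    rintro ⟨B, hBm, hBi, hB⟩
    have hU : B = ⋃ i, B ∩ orbitMap Γ H ⁻¹' A i := by
      rw [← inter_iUnion, ← preimage_iUnion, inter_eq_left.2 hB]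
    calc m B = m (⋃ i, B ∩ orbitMap Γ H ⁻¹' A i) := by rw [← hU]
      _ ≤ ∑' i, m (B ∩ orbitMap Γ H ⁻¹' A i) := measure_iUnion_le _
      _ ≤ ∑' i, quotientMass Γ H m (A i) :=
          ENNReal.tsum_le_tsum fun i => le_quotientMass Γ H m
            (hBm.inter (measurable_orbitMap Γ H (hA i))) (hBi.mono inter_subset_left)
            inter_subset_right
  · by_cases htop : quotientMass Γ H m (⋃ i, A i) = ∞
    · rw [htop]; exact le_top
    have hmono : ∀ i, quotientMass Γ H m (A i) ≤ quotientMass Γ H m (⋃ i, A i) := fun i => by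
      refine iSup_le ?_
      rintro ⟨B, h1, h2, h3⟩
      exact le_quotientMass Γ H m h1 h2 (h3.trans (preimage_mono (subset_iUnion A i)))
    refine ENNReal.le_of_forall_pos_le_add fun ε hε _ => ?_
    obtain ⟨δ, hδ, hsum⟩ := ENNReal.exists_pos_sum_of_countable' (ENNReal.coe_pos.2 hε).ne' ℕ
    have hex : ∀ i, ∃ B : Set H, (MeasurableSet B ∧ InjOn (orbitMap Γ H) B ∧
        B ⊆ orbitMap Γ H ⁻¹' A i) ∧ quotientMass Γ H m (A i) ≤ m B + δ i := by
      intro i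
      by_cases h0 : quotientMass Γ H m (A i) = 0
      · exact ⟨∅, ⟨MeasurableSet.empty, injOn_empty _, empty_subset _⟩, by simp [h0]⟩
      have hlt : quotientMass Γ H m (A i) - δ i < quotientMass Γ H m (A i) :=
        ENNReal.sub_lt_self (ne_top_of_le_ne_top htop (hmono i)) h0 (hδ i).ne'
      obtain ⟨B, hB⟩ := lt_iSup_iff.1 hlt
      exact ⟨B.1, B.2, tsub_le_iff_right.1 hB.le⟩
    choose B hB hBle using hex
    have hdis : Pairwise (Function.onFun Disjoint B) := fun i j hij =>
      ((hd hij).preimage (orbitMap Γ H)).mono (hB i).2.2 (hB j).2.2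
    calc ∑' i, quotientMass Γ H m (A i) ≤ ∑' i, (m (B i) + δ i) := ENNReal.tsum_le_tsum hBle
      _ = m (⋃ i, B i) + ∑' i, δ i := by
          rw [ENNReal.tsum_add, measure_iUnion hdis fun i => (hB i).1]
      _ ≤ quotientMass Γ H m (⋃ i, A i) + ε := by
          refine add_le_add (le_quotientMass Γ H m (MeasurableSet.iUnion fun i => (hB i).1) ?_ ?_)
            hsum.le
          · intro x hx y hy hxy
            obtain ⟨i, hi⟩ := mem_iUnion.1 hx
            obtain ⟨j, hj⟩ := mem_iUnion.1 hy
            have hij : i = j := by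
              by_contra hne
              refine disjoint_left.1 (hd hne) ((hB i).2.2 hi) ?_
              rw [hxy]
              exact (hB j).2.2 hj
            subst hij
            exact (hB i).2.1 hi hj hxy
          · exact iUnion_subset fun i => (hB i).2.2.trans (preimage_mono (subset_iUnion A i))

/-- The measure on `G ⧸ Γ` induced by a measure `m` on the subgroup `H`. -/
noncomputable def quotientMeasure (Γ H : Subgroup G) (m : Measure H) : Measure (G ⧸ Γ) :=
  Measure.ofMeasurable (fun A _ => quotientMass Γ H m A) (quotientMass_empty Γ H m)
    fun _ hA hd => quotientMass_iUnion Γ H m hA hd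

/-- The `H`-invariant probability measure supported on `H Γ ⊆ G ⧸ Γ`, for a closed unimodular
subgroup `H` in which `H ∩ Γ` is a lattice: the measure induced by a Haar measure of `H`,
divided by its total mass. -/
noncomputable def homMeasure [TopologicalSpace G] [IsTopologicalGroup G] [BorelSpace G]
    (Γ H : Subgroup G) [LocallyCompactSpace H] : Measure (G ⧸ Γ) :=
  (quotientMeasure Γ H (Measure.haar : Measure H) univ)⁻¹ •
    quotientMeasure Γ H (Measure.haar : Measure H)

end HomogeneousMeasure

/-! ### The space of unimodular lattices in `ℝ³` -/

/-- `SL(3, ℝ)` carries its Borel σ-algebra. -/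
instance : MeasurableSpace SL(3, ℝ) := borel _

instance : BorelSpace SL(3, ℝ) := ⟨rfl⟩

/-- `SL(3, ℤ)` as a subgroup of `SL(3, ℝ)`. -/
def Gam : Subgroup SL(3, ℝ) :=
  (Matrix.SpecialLinearGroup.map (n := Fin 3) (Int.castRingHom ℝ)).range

/-- The space `X = SL(3, ℝ) ⧸ SL(3, ℤ)` of unimodular lattices in `ℝ³`. -/
abbrev X : Type := SL(3, ℝ) ⧸ Gam

/-- The lattice `g ℤ³ ⊆ ℝ³` that corresponds to the point `g SL(3, ℤ)` of `X`. -/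
def latticeOf (x : X) : Set (Fin 3 → ℝ) :=
  {w | ∃ g : SL(3, ℝ), (g : X) = x ∧ ∃ v : Fin 3 → ℤ,
    w = (g : Matrix (Fin 3) (Fin 3) ℝ).mulVec fun i => (v i : ℝ)}

/-- The Siegel transform `Λ ↦ ∑_{λ ∈ Λ \ {0}} f(λ)`. -/
noncomputable def siegel (f : (Fin 3 → ℝ) → ℝ) (x : X) : ℝ :=
  ∑' w : ↥(latticeOf x \ {0}), f w

/-- The diagonal matrix `a(t) = diag(e^{t₁}, e^{t₂}, e^{-t₁-t₂})`. -/
noncomputable def a (t₁ t₂ : ℝ) : SL(3, ℝ) :=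
  ⟨Matrix.diagonal ![Real.exp t₁, Real.exp t₂, Real.exp (-t₁ - t₂)], by
    simp [Matrix.det_diagonal, Fin.prod_univ_three, ← Real.exp_add]⟩

/-- The group of matrices in `SL(3, ℝ)` whose `j`-th column is that of the identity matrix. -/
def fixCol (j : Fin 3) : Subgroup SL(3, ℝ) where
  carrier := {g | ∀ i, (g : Matrix (Fin 3) (Fin 3) ℝ) i j = (1 : Matrix (Fin 3) (Fin 3) ℝ) i j}
  one_mem' := fun i => by rw [Matrix.SpecialLinearGroup.coe_one]
  mul_mem' := by
    intro g h hg hh i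
    simp only [mem_ofPred_eq] at hg hh
    rw [Matrix.SpecialLinearGroup.coe_mul, Matrix.mul_apply]
    simp only [hh, ← Matrix.mul_apply, mul_one, hg]
  inv_mem' := by
    intro g hg i
    simp only [mem_ofPred_eq] at hg
    have h : ((g⁻¹ * g : SL(3, ℝ)) : Matrix (Fin 3) (Fin 3) ℝ) i j =
        ((g⁻¹ : SL(3, ℝ)) : Matrix (Fin 3) (Fin 3) ℝ) i j := by
      rw [Matrix.SpecialLinearGroup.coe_mul, Matrix.mul_apply]
      simp only [hg, ← Matrix.mul_apply, mul_one]
    rw [← h, inv_mul_cancel, Matrix.SpecialLinearGroup.coe_one]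

instance (j : Fin 3) : LocallyCompactSpace (fixCol j) := by
  have hM : LocallyCompactSpace (Matrix (Fin 3) (Fin 3) ℝ) :=
    inferInstanceAs (LocallyCompactSpace (Fin 3 → Fin 3 → ℝ))
  have hG : LocallyCompactSpace SL(3, ℝ) :=
    (Matrix.SpecialLinearGroup.isClosedEmbedding_val
      (n := Fin 3) (R := ℝ)).locallyCompactSpace
  have hc : IsClosed ((fixCol j : Subgroup SL(3, ℝ)) : Set SL(3, ℝ)) := by
    have : ((fixCol j : Subgroup SL(3, ℝ)) : Set SL(3, ℝ)) =
        ⋂ i, {g : SL(3, ℝ) | (g : Matrix (Fin 3) (Fin 3) ℝ) i j = (1 : Matrix (Fin 3) (Fin 3) ℝ) i j} := by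
      ext g
      simp [fixCol]
    rw [this]
    refine isClosed_iInter fun i => isClosed_eq ?_ continuous_const
    exact (continuous_apply j).comp
      (Matrix.SpecialLinearGroup.continuous_apply (fun g : SL(3, ℝ) => g) continuous_id i)
  exact hc.isClosedEmbedding_subtypeVal.locallyCompactSpace

/-- The matrices with rows `(*, 0, *)`, `(*, 1, *)`, `(*, 0, *)`. -/
abbrev G₁ : Subgroup SL(3, ℝ) := fixCol 1

/-- The matrices with rows `(1, *, *)`, `(0, *, *)`, `(0, *, *)`. -/
abbrev G₂ : Subgroup SL(3, ℝ) := fixCol 0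

/-- `Y₁ = G₁ Γ`. -/
def Y₁ : Set X := homSubspace Gam G₁

/-- `Y₂ = G₂ Γ`. -/
def Y₂ : Set X := homSubspace Gam G₂

/-- The invariant probability measure supported on `Y₁`. -/
noncomputable def ν₁ : Measure X := homMeasure Gam G₁

/-- The invariant probability measure supported on `Y₂`. -/
noncomputable def ν₂ : Measure X := homMeasure Gam G₂

end LatticeSpace

/-! An element of either stabilizer is, up to a permutation of coordinates, a block matrix with rows
`(1, u)` and `(0, w)`, where `det₂ w = 1`. Its lattice consists of the points `(k + u·v, w v)` with
`k ∈ ℤ`, `v ∈ ℤ²`. Let `N` be the exponent in the fixed direction. After `a(n)`, membership in the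
support of `f` forces `k + u·v` into `[-ε, ε]` with `ε = c e^{-N}`, and `w v` into a rectangle of
area proportional to `c β e^N`. Invariance under a diagonal element of the block turns this
rectangle into the square of radius `R = √(c β e^N)`. Since `ε < 1`, the vectors with `v = 0` drop
out, so the Siegel transform is at most three times the number of nonzero `v` with `‖w v‖ ≤ R` for
which `u·v` lies within `ε` of an integer.

For fixed reduced `w`, the `p`-th moment in `u` over the torus is estimated in two pieces. Multiples
of the short basis vector: there are at most `2R/‖w.1‖` of them, and the trivial bound together with
the first moment gives `O(ε (R/‖w.1‖)^p)`. Remaining `v`: these are sorted by their gcd `k`. Within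
one layer, vectors that are not equal or opposite are linearly independent, so their events are
independent, and the second moment is controlled by the mean `O(ε R²/k²)`. The `L^p` norms of the
layers decay like `k^{-2/p}`, which is summable for `p < 2` (`exists_lintegral_returnCount_le`).

Haar measure is realized by Lebesgue measure on the cone of matrices with determinant in `(0, 1]`
times row vectors (`exists_haar_eq_smul`), and the quotient measure is bounded by integration over
reduced matrices (`quotientMeasure_le_map`). There `‖w.1‖^{-p}` is integrable, again because `p < 2`
(`lintegral_reducedCone_ne_top`). Finally `ε R² = c² β` and `ε R^p ≤ β^{p/2}`, uniformly in `n`. -/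

namespace LatticeSpace

open MeasureTheory Set
open scoped ENNReal MatrixGroups

/-! ### Close returns of integer combinations on the two-dimensional torus -/

/-- The character combination `t ↦ v₁ t₁ + v₂ t₂` on the torus. -/
noncomputable def torusHom (v : ℤ × ℤ) : UnitAddCircle × UnitAddCircle →+ UnitAddCircle :=
  ((zsmulAddGroupHom v.1).comp (AddMonoidHom.fst _ _)) +
    ((zsmulAddGroupHom v.2).comp (AddMonoidHom.snd _ _))

lemma torusHom_apply (v : ℤ × ℤ) (t : UnitAddCircle × UnitAddCircle) :
    torusHom v t = v.1 • t.1 + v.2 • t.2 := rfl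

lemma continuous_torusHom (v : ℤ × ℤ) : Continuous (torusHom v) := by
  change Continuous fun t : UnitAddCircle × UnitAddCircle => v.1 • t.1 + v.2 • t.2
  fun_prop

lemma exists_zsmul_eq {n : ℤ} (hn : n ≠ 0) (t : UnitAddCircle) : ∃ s, n • s = t := by
  obtain ⟨x, rfl⟩ := QuotientAddGroup.mk_surjective t
  refine ⟨((x / n : ℝ) : UnitAddCircle), ?_⟩
  rw [← AddCircle.coe_zsmul]
  have : (n : ℝ) ≠ 0 := by exact_mod_cast hn
  congr 1
  rw [zsmul_eq_mul]
  field_simp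

lemma surjective_torusHom {v : ℤ × ℤ} (hv : v ≠ 0) : Function.Surjective (torusHom v) := by
  intro t
  by_cases h : v.1 = 0
  · have h2 : v.2 ≠ 0 := fun h2 => hv (Prod.ext h h2)
    obtain ⟨s, hs⟩ := exists_zsmul_eq h2 t
    exact ⟨(0, s), by simp [torusHom_apply, hs]⟩
  · obtain ⟨s, hs⟩ := exists_zsmul_eq h t
    exact ⟨(s, 0), by simp [torusHom_apply, hs]⟩

/-- The circle is divisible, so both targets are multiples of the determinant, and Cramer's rule
then solves the system over `ℤ`. -/
lemma surjective_torusHom_prod {v w : ℤ × ℤ} (h : v.1 * w.2 - v.2 * w.1 ≠ 0) :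
    Function.Surjective ((torusHom v).prod (torusHom w)) := by
  rintro ⟨s, t⟩
  obtain ⟨s, rfl⟩ := exists_zsmul_eq h s
  obtain ⟨t, rfl⟩ := exists_zsmul_eq h t
  refine ⟨(w.2 • s - v.2 • t, v.1 • t - w.1 • s), Prod.ext ?_ ?_⟩ <;>
  · simp only [AddMonoidHom.prod_apply, torusHom_apply, smul_sub, smul_smul, sub_smul]
    module

instance : Measure.IsAddHaarMeasure (volume : Measure (UnitAddCircle × UnitAddCircle)) :=
  inferInstanceAs (Measure.IsAddHaarMeasure
    ((volume : Measure UnitAddCircle).prod (volume : Measure UnitAddCircle)))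

lemma volume_torus_univ : (volume : Measure (UnitAddCircle × UnitAddCircle)) univ = 1 := by
  change ((volume : Measure UnitAddCircle).prod (volume : Measure UnitAddCircle)) univ = 1
  rw [← univ_prod_univ, Measure.prod_prod]
  simp

/-- The points of the torus at which `v` takes a value of norm at most `ε`. -/
def nearReturn (ε : ℝ) (v : ℤ × ℤ) : Set (UnitAddCircle × UnitAddCircle) :=
  torusHom v ⁻¹' Metric.closedBall 0 ε

lemma measurableSet_nearReturn (ε : ℝ) (v : ℤ × ℤ) : MeasurableSet (nearReturn ε v) :=
  (continuous_torusHom v).measurable Metric.isClosed_closedBall.measurableSet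

lemma volume_circle_closedBall_le (ε : ℝ) :
    volume (Metric.closedBall (0 : UnitAddCircle) ε) ≤ ENNReal.ofReal (2 * ε) := by
  rw [AddCircle.volume_closedBall]
  exact ENNReal.ofReal_le_ofReal (min_le_right _ _)

/-- A continuous surjective homomorphism of compact groups carries Haar probability measure to Haar
probability measure. -/
lemma volume_nearReturn_le (ε : ℝ) {v : ℤ × ℤ} (hv : v ≠ 0) :
    volume (nearReturn ε v) ≤ ENNReal.ofReal (2 * ε) := by
  have h := AddMonoidHom.measurePreserving (μ := volume) (ν := volume) (f := torusHom v)
    (continuous_torusHom v) (surjective_torusHom hv) (by rw [volume_torus_univ]; simp)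
  rw [nearReturn, h.measure_preimage Metric.isClosed_closedBall.measurableSet.nullMeasurableSet]
  exact volume_circle_closedBall_le ε

/-- Pairwise independence: the joint map of two nonparallel `v`, `w` also preserves Haar measure, so
the two events have product measure. -/
lemma volume_nearReturn_inter_le (ε : ℝ) {v w : ℤ × ℤ} (h : v.1 * w.2 - v.2 * w.1 ≠ 0) :
    volume (nearReturn ε v ∩ nearReturn ε w) ≤ ENNReal.ofReal (2 * ε) ^ 2 := by
  have hm := AddMonoidHom.measurePreserving (μ := volume) (ν := volume)
    (f := (torusHom v).prod (torusHom w))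
    ((continuous_torusHom v).prodMk (continuous_torusHom w)) (surjective_torusHom_prod h) rfl
  have : nearReturn ε v ∩ nearReturn ε w =
      (torusHom v).prod (torusHom w) ⁻¹'
        (Metric.closedBall 0 ε ×ˢ Metric.closedBall 0 ε) := rfl
  rw [this, hm.measure_preimage (Metric.isClosed_closedBall.measurableSet.prod
    Metric.isClosed_closedBall.measurableSet).nullMeasurableSet]
  change ((volume : Measure UnitAddCircle).prod (volume : Measure UnitAddCircle)) _ ≤ _
  rw [Measure.prod_prod, sq]
  gcongr <;> exact volume_circle_closedBall_le ε

/-- The number of `v ∈ V` for which `t` is a near return. -/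
noncomputable def returnCount (ε : ℝ) (V : Set (ℤ × ℤ)) (t : UnitAddCircle × UnitAddCircle) :
    ℝ≥0∞ :=
  ∑' v : V, (nearReturn ε v).indicator 1 t

lemma measurable_returnCount (ε : ℝ) (V : Set (ℤ × ℤ)) : Measurable (returnCount ε V) :=
  Measurable.tsum fun v =>
    measurable_one.indicator (measurableSet_nearReturn ε v)

lemma returnCount_le_encard (ε : ℝ) (V : Set (ℤ × ℤ)) (t) : returnCount ε V t ≤ V.encard := by
  rw [← ENNReal.tsum_set_one]
  exact ENNReal.tsum_le_tsum fun v => indicator_le_self' (fun _ _ => zero_le) t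

lemma lintegral_returnCount_le (ε : ℝ) {V : Set (ℤ × ℤ)} (hV : 0 ∉ V) :
    ∫⁻ t, returnCount ε V t ≤ V.encard * ENNReal.ofReal (2 * ε) := by
  unfold returnCount
  rw [lintegral_tsum fun v : V => (measurable_one.indicator
    (measurableSet_nearReturn ε v)).aemeasurable, ← ENNReal.tsum_set_one, ← ENNReal.tsum_mul_right]
  refine ENNReal.tsum_le_tsum fun v => ?_
  rw [lintegral_indicator_one (measurableSet_nearReturn ε v), one_mul]
  exact volume_nearReturn_le ε fun h => hV (h ▸ v.2)

/-- The square expands into a sum over pairs. Independent pairs give the squared bound for the mean;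
for each `v` only `w = v` and `w = -v` remain, which gives the linear term with factor 2. -/
lemma lintegral_returnCount_sq_le (ε : ℝ) {V : Set (ℤ × ℤ)} (hV : 0 ∉ V)
    (hind : ∀ v ∈ V, ∀ w ∈ V, w = v ∨ w = -v ∨ v.1 * w.2 - v.2 * w.1 ≠ 0) :
    ∫⁻ t, returnCount ε V t ^ 2 ≤
      (V.encard * ENNReal.ofReal (2 * ε)) ^ 2 + 2 * (V.encard * ENNReal.ofReal (2 * ε)) := by
  classical
  have hsq : ∀ t, returnCount ε V t ^ 2 =
      ∑' v : V, ∑' w : V, (nearReturn ε v ∩ nearReturn ε w).indicator (1 : UnitAddCircle × UnitAddCircle → ℝ≥0∞) t := by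
    intro t
    rw [sq, returnCount, ← ENNReal.tsum_mul_right]
    refine tsum_congr fun v => ?_
    rw [← ENNReal.tsum_mul_left]
    refine tsum_congr fun w => ?_
    rw [inter_indicator_one]
    rfl
  simp_rw [hsq]
  have hmeas : ∀ v w : ℤ × ℤ, MeasurableSet (nearReturn ε v ∩ nearReturn ε w) := fun v w =>
    (measurableSet_nearReturn ε v).inter (measurableSet_nearReturn ε w)
  rw [lintegral_tsum fun v : V => (Measurable.tsum fun w : V =>
    measurable_one.indicator (hmeas v w)).aemeasurable]
  have hone : ∀ u : ℤ × ℤ, ∑' w : V, (if (w : ℤ × ℤ) = u then (1 : ℝ≥0∞) else 0) ≤ 1 := by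
    intro u
    calc ∑' w : V, (if (w : ℤ × ℤ) = u then (1 : ℝ≥0∞) else 0)
        ≤ ∑' w : ℤ × ℤ, (if w = u then (1 : ℝ≥0∞) else 0) :=
          ENNReal.tsum_comp_le_tsum_of_injective Subtype.val_injective _
      _ = 1 := tsum_ite_eq u _
  have hpt : ∀ v w : V, ∫⁻ t, (nearReturn ε v ∩ nearReturn ε w).indicator (1 : UnitAddCircle × UnitAddCircle → ℝ≥0∞) t ≤
      ENNReal.ofReal (2 * ε) ^ 2 + ENNReal.ofReal (2 * ε) *
        ((if (w : ℤ × ℤ) = v then 1 else 0) + (if (w : ℤ × ℤ) = -v then 1 else 0)) := by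
    intro v w
    rw [lintegral_indicator_one (hmeas v w)]
    have hle : volume (nearReturn ε v ∩ nearReturn ε w) ≤ ENNReal.ofReal (2 * ε) :=
      (measure_mono inter_subset_left).trans
        (volume_nearReturn_le ε fun h => hV (h ▸ v.2))
    rcases hind v v.2 w w.2 with h | h | h
    · refine hle.trans (le_add_left ?_)
      rw [if_pos h]
      exact le_mul_of_one_le_right' le_self_add
    · refine hle.trans (le_add_left ?_)
      rw [if_pos h]
      exact le_mul_of_one_le_right' le_add_self
    · exact (volume_nearReturn_inter_le ε h).trans le_self_add
  have hrow : ∀ v : V, ∫⁻ t, ∑' w : V,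
      (nearReturn ε v ∩ nearReturn ε w).indicator (1 : UnitAddCircle × UnitAddCircle → ℝ≥0∞) t ≤
      V.encard * ENNReal.ofReal (2 * ε) ^ 2 + 2 * ENNReal.ofReal (2 * ε) := by
    intro v
    rw [lintegral_tsum fun w : V => (measurable_one.indicator (hmeas v w)).aemeasurable]
    refine (ENNReal.tsum_le_tsum fun w => hpt v w).trans ?_
    rw [ENNReal.tsum_add, ENNReal.tsum_mul_left, ENNReal.tsum_add,
      mul_comm 2 (ENNReal.ofReal (2 * ε))]
    refine add_le_add ?_ ?_
    · rw [← ENNReal.tsum_set_one, ← ENNReal.tsum_mul_right]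
      simp
    · gcongr
      exact (add_le_add (hone _) (hone _)).trans (le_of_eq one_add_one_eq_two)
  refine (ENNReal.tsum_le_tsum hrow).trans (le_of_eq ?_)
  have : ∀ x : ℝ≥0∞, ∑' _ : V, x = V.encard * x := fun x => by
    rw [← ENNReal.tsum_set_one, ← ENNReal.tsum_mul_right]; simp
  rw [this]
  ring

lemma one_le_returnCount {ε : ℝ} {V : Set (ℤ × ℤ)} {t} (h : returnCount ε V t ≠ 0) :
    1 ≤ returnCount ε V t := by
  rw [returnCount, Ne, ENNReal.tsum_eq_zero, not_forall] at h
  obtain ⟨v, hv⟩ := h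
  refine le_trans ?_ (ENNReal.le_tsum v)
  rw [indicator_of_mem (mem_of_indicator_ne_zero hv)]
  rfl

/-- A count is either zero or at least one, so powers increase with the exponent. -/
lemma returnCount_rpow_le_sq {ε p : ℝ} (hp1 : 1 ≤ p) (hp2 : p ≤ 2) {V : Set (ℤ × ℤ)} (t) :
    returnCount ε V t ^ p ≤ returnCount ε V t ^ 2 := by
  by_cases h : returnCount ε V t = 0
  · rw [h, ENNReal.zero_rpow_of_pos (by linarith)]
    exact zero_le
  · rw [← ENNReal.rpow_two]
    exact ENNReal.rpow_le_rpow_of_exponent_le (one_le_returnCount h) hp2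

/-- A first moment estimate, raised to the power `p` by means of the trivial bound. -/
lemma lintegral_returnCount_rpow_le_of_encard (ε : ℝ) {p : ℝ} (hp : 1 ≤ p) {V : Set (ℤ × ℤ)}
    (hV : 0 ∉ V) :
    ∫⁻ t, returnCount ε V t ^ p ≤ (V.encard : ℝ≥0∞) ^ p * ENNReal.ofReal (2 * ε) := by
  by_cases htop : (V.encard : ℝ≥0∞) = ∞
  -- If this factor vanishes, the right-hand side is `∞ * 0 = 0`, and the count has to vanish almost
  -- everywhere.
  · by_cases hε : ENNReal.ofReal (2 * ε) = 0
    · have h0 : ∫⁻ t, returnCount ε V t = 0 :=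
        le_antisymm ((lintegral_returnCount_le ε hV).trans (by rw [hε, mul_zero])) zero_le
      rw [lintegral_eq_zero_iff (measurable_returnCount ε V)] at h0
      rw [hε, mul_zero, nonpos_iff_eq_zero,
        lintegral_eq_zero_iff ((measurable_returnCount ε V).pow_const p)]
      filter_upwards [h0] with t ht
      rw [ht]
      simpa using by linarith
    · rw [htop, ENNReal.top_rpow_of_pos (by linarith), ENNReal.top_mul hε]
      exact le_top
  have hsplit : ∀ x : ℝ≥0∞, x ≠ ∞ → x ^ p = x ^ (p - 1) * x := fun x hx => by
    by_cases h0 : x = 0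
    · rw [h0, mul_zero, ENNReal.zero_rpow_of_pos (by linarith)]
    · conv_rhs => rw [← ENNReal.rpow_one x]
      rw [← ENNReal.rpow_mul, one_mul, ← ENNReal.rpow_add _ _ h0 hx, sub_add_cancel]
  calc ∫⁻ t, returnCount ε V t ^ p
      ≤ ∫⁻ t, (V.encard : ℝ≥0∞) ^ (p - 1) * returnCount ε V t := by
        refine lintegral_mono fun t => ?_
        have hle := returnCount_le_encard ε V t
        simp only
        rw [hsplit _ (ne_top_of_le_ne_top htop hle)]
        gcongr
    _ = (V.encard : ℝ≥0∞) ^ (p - 1) * ∫⁻ t, returnCount ε V t :=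
        lintegral_const_mul _ (measurable_returnCount ε V)
    _ ≤ (V.encard : ℝ≥0∞) ^ (p - 1) * (V.encard * ENNReal.ofReal (2 * ε)) := by
        gcongr
        exact lintegral_returnCount_le ε hV
    _ = _ := by rw [← mul_assoc, ← hsplit _ htop]

/-! ### Counting integers and lattice points -/

/-- Omitting zero removes the additive constant, so the bound stays proportional to `Y` even for
small `Y`. -/
lemma encard_int_abs_le {Y : ℝ} (hY : 0 ≤ Y) :
    (({b : ℤ | b ≠ 0 ∧ |(b : ℝ)| ≤ Y}.encard : ℕ∞) : ℝ≥0∞) ≤ ENNReal.ofReal (2 * Y) := by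
  have hsub : {b : ℤ | b ≠ 0 ∧ |(b : ℝ)| ≤ Y} ⊆ ((Finset.Icc (-⌊Y⌋) ⌊Y⌋).erase 0 : Finset ℤ) := by
    rintro b ⟨hb, h⟩
    rw [abs_le] at h
    rw [Finset.mem_coe, Finset.mem_erase, Finset.mem_Icc]
    refine ⟨hb, ?_, Int.le_floor.2 h.2⟩
    have : -b ≤ ⌊Y⌋ := Int.le_floor.2 (by push_cast; linarith)
    omega
  have h0 : 0 ≤ ⌊Y⌋ := Int.floor_nonneg.2 hY
  have hcard : (((Finset.Icc (-⌊Y⌋) ⌊Y⌋).erase 0).card : ℤ) = 2 * ⌊Y⌋ := by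
    rw [Finset.card_erase_of_mem (by simp [h0]), Int.card_Icc]
    omega
  have h1 := encard_le_encard hsub
  rw [encard_coe_eq_coe_finsetCard] at h1
  refine (ENat.toENNReal_le.2 h1).trans ?_
  rw [ENat.toENNReal_coe, ENNReal.le_ofReal_iff_toReal_le (by simp) (by positivity),
    ENNReal.toReal_natCast]
  have : (((((Finset.Icc (-⌊Y⌋) ⌊Y⌋).erase 0).card : ℕ) : ℤ) : ℝ) = ((2 * ⌊Y⌋ : ℤ) : ℝ) := by
    rw [hcard]
  push_cast at this
  rw [this]
  linarith [Int.floor_le Y]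

lemma encard_int_abs_add_le (y : ℝ) {T : ℝ} (hT : 0 ≤ T) :
    (({a : ℤ | |(a : ℝ) + y| ≤ T}.encard : ℕ∞) : ℝ≥0∞) ≤ ENNReal.ofReal (2 * T + 1) := by
  have hsub : {a : ℤ | |(a : ℝ) + y| ≤ T} ⊆ (Finset.Icc ⌈-y - T⌉ ⌊-y + T⌋ : Finset ℤ) := by
    intro a h
    rw [mem_ofPred_eq, abs_le] at h
    rw [Finset.mem_coe, Finset.mem_Icc]
    exact ⟨Int.ceil_le.2 (by linarith), Int.le_floor.2 (by linarith)⟩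
  have h1 := encard_le_encard hsub
  rw [encard_coe_eq_coe_finsetCard] at h1
  refine (ENat.toENNReal_le.2 h1).trans ?_
  rw [ENat.toENNReal_coe, ENNReal.le_ofReal_iff_toReal_le (by simp) (by positivity),
    ENNReal.toReal_natCast, Int.card_Icc]
  have h2 := Int.floor_le (-y + T)
  have h3 := Int.le_ceil (-y - T)
  rcases le_total 0 (⌊-y + T⌋ + 1 - ⌈-y - T⌉) with h | h
  · have : (((⌊-y + T⌋ + 1 - ⌈-y - T⌉).toNat : ℤ) : ℝ) =
      ((⌊-y + T⌋ + 1 - ⌈-y - T⌉ : ℤ) : ℝ) := by rw [Int.toNat_of_nonneg h]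
    push_cast at this
    rw [this]
    linarith
  · rw [Int.toNat_of_nonpos h]
    simp only [Nat.cast_zero]
    positivity

/-- The vector with coordinates `v` in the basis `w`. -/
def latVec (w : (ℝ × ℝ) × (ℝ × ℝ)) (v : ℤ × ℤ) : ℝ × ℝ := (v.1 : ℝ) • w.1 + (v.2 : ℝ) • w.2

/-- The determinant of a pair of column vectors. -/
def det₂ {R : Type*} [CommRing R] (w : (R × R) × (R × R)) : R :=
  w.1.1 * w.2.2 - w.2.1 * w.1.2

lemma norm_fst_pos {w : (ℝ × ℝ) × (ℝ × ℝ)} (hw : 0 < det₂ w) : 0 < ‖w.1‖ := by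
  rw [norm_pos_iff]
  intro h
  simp [det₂, h] at hw

/-- In the coordinate where `w.1` attains its sup norm, consecutive points of the row are exactly
`‖w.1‖` apart. -/
lemma encard_row_le {w : (ℝ × ℝ) × (ℝ × ℝ)} (hw : det₂ w = 1) {T : ℝ} (hT : 0 ≤ T) (b : ℤ) :
    (({a : ℤ | ‖latVec w (a, b)‖ ≤ T}.encard : ℕ∞) : ℝ≥0∞) ≤
      ENNReal.ofReal (2 * (T / ‖w.1‖) + 1) := by
  have hr : 0 < ‖w.1‖ := norm_fst_pos (by rw [hw]; exact one_pos)
  have key : ∀ x y : ℝ, ‖w.1‖ = |x| → {a : ℤ | ‖latVec w (a, b)‖ ≤ T} ⊆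
      {a : ℤ | |(a : ℝ) * x + b * y| ≤ T} →
      (({a : ℤ | ‖latVec w (a, b)‖ ≤ T}.encard : ℕ∞) : ℝ≥0∞) ≤
      ENNReal.ofReal (2 * (T / ‖w.1‖) + 1) := by
    intro x y hx hsub
    have hx0 : x ≠ 0 := by rw [← abs_pos, ← hx]; exact hr
    refine le_trans (ENat.toENNReal_le.2 (encard_le_encard (hsub.trans fun a ha => ?_)))
      (encard_int_abs_add_le (b * y / x) (by positivity))
    rw [mem_ofPred_eq] at ha ⊢
    rw [hx, le_div_iff₀ (abs_pos.2 hx0), ← abs_mul]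
    refine le_trans (le_of_eq ?_) ha
    congr 1
    field_simp
  rcases le_total ‖w.1.1‖ ‖w.1.2‖ with h | h
  · refine key w.1.2 w.2.2 (by rw [Prod.norm_def, max_eq_right h, Real.norm_eq_abs]) fun a ha => ?_
    exact (norm_snd_le (latVec w (a, b))).trans ha
  · refine key w.1.1 w.2.1 (by rw [Prod.norm_def, max_eq_left h, Real.norm_eq_abs]) fun a ha => ?_
    exact (norm_fst_le (latVec w (a, b))).trans ha

/-- Cramer's rule: `v.2` is the determinant of `w.1` and `latVec w v`. -/
lemma abs_snd_le_of_norm_latVec_le {w : (ℝ × ℝ) × (ℝ × ℝ)} (hw : det₂ w = 1) {T : ℝ} {v : ℤ × ℤ}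
    (h : ‖latVec w v‖ ≤ T) : |(v.2 : ℝ)| ≤ 2 * ‖w.1‖ * T := by
  have h1 : (v.2 : ℝ) = w.1.1 * (latVec w v).2 - (latVec w v).1 * w.1.2 := by
    simp only [latVec, Prod.snd_add, Prod.fst_add, Prod.smul_fst, Prod.smul_snd, smul_eq_mul]
    rw [det₂] at hw
    linear_combination -(v.2 : ℝ) * hw
  have a1 : |w.1.1| ≤ ‖w.1‖ := norm_fst_le w.1
  have a2 : |w.1.2| ≤ ‖w.1‖ := norm_snd_le w.1
  have a3 : |(latVec w v).1| ≤ T := (norm_fst_le (latVec w v)).trans h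
  have a4 : |(latVec w v).2| ≤ T := (norm_snd_le (latVec w v)).trans h
  have hT : 0 ≤ T := (norm_nonneg _).trans h
  rw [h1]
  refine (abs_sub _ _).trans ?_
  rw [abs_mul, abs_mul]
  have b1 := mul_le_mul a1 a4 (abs_nonneg _) (norm_nonneg _)
  have b2 := mul_le_mul a3 a2 (abs_nonneg _) hT
  linarith

/-- The number of points of a unimodular lattice in a square, off the line through a short vector. -/
lemma encard_latVec_le {w : (ℝ × ℝ) × (ℝ × ℝ)} (hw : det₂ w = 1) (hs : ‖w.1‖ ^ 2 ≤ 2) {T : ℝ}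
    (hT : 0 ≤ T) :
    (({v : ℤ × ℤ | v.2 ≠ 0 ∧ ‖latVec w v‖ ≤ T}.encard : ℕ∞) : ℝ≥0∞) ≤
      ENNReal.ofReal (24 * T ^ 2) := by
  have hr : 0 < ‖w.1‖ := norm_fst_pos (by rw [hw]; exact one_pos)
  set r := ‖w.1‖ with hrdef
  set Bs : Set ℤ := {b : ℤ | b ≠ 0 ∧ |(b : ℝ)| ≤ 2 * r * T} with hBs
  set A : ℤ → Set (ℤ × ℤ) := fun b => (fun a => (a, b)) '' {a : ℤ | ‖latVec w (a, b)‖ ≤ T}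
  have hsub : {v : ℤ × ℤ | v.2 ≠ 0 ∧ ‖latVec w v‖ ≤ T} ⊆ ⋃ b ∈ Bs, A b := by
    rintro ⟨a, b⟩ ⟨hb, hv⟩
    exact mem_iUnion₂.2 ⟨b, ⟨hb, abs_snd_le_of_norm_latVec_le hw hv⟩, a, hv, rfl⟩
  have hrow : ∀ b : Bs, ((A b).encard : ℝ≥0∞) ≤ ENNReal.ofReal (6 * (T / r)) := by
    rintro ⟨b, hb0, hb⟩
    refine (ENat.toENNReal_le.2 (encard_image_le _ _)).trans ((encard_row_le hw hT b).trans ?_)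
    refine ENNReal.ofReal_le_ofReal ?_
    have h1 : (1 : ℝ) ≤ |(b : ℝ)| := by
      rw [← Int.cast_abs]
      exact_mod_cast Int.one_le_abs hb0
    -- From `1 ≤ |b| ≤ 2 r T` and `r² ≤ 2` one gets `r ≤ 2 r² T ≤ 4 T`; this absorbs the `+ 1` of
    -- the row count.
    have h2 : 1 ≤ 4 * (T / r) := by
      rw [← mul_div_assoc, le_div_iff₀ hr]
      nlinarith
    rw [← hrdef]
    linarith
  calc (({v : ℤ × ℤ | v.2 ≠ 0 ∧ ‖latVec w v‖ ≤ T}.encard : ℕ∞) : ℝ≥0∞)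
      ≤ ((⋃ b ∈ Bs, A b).encard : ℝ≥0∞) := ENat.toENNReal_le.2 (encard_le_encard hsub)
    _ ≤ ∑' b : Bs, ((A b).encard : ℝ≥0∞) := by
        simp_rw [← ENNReal.tsum_set_one]
        exact ENNReal.tsum_biUnion_le_tsum (fun _ => 1) Bs A
    _ ≤ ∑' b : Bs, 1 * ENNReal.ofReal (6 * (T / r)) := by
        simp_rw [one_mul]
        exact ENNReal.tsum_le_tsum hrow
    _ ≤ ENNReal.ofReal (2 * (2 * r * T)) * ENNReal.ofReal (6 * (T / r)) := by
        rw [ENNReal.tsum_mul_right, ENNReal.tsum_set_one]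
        gcongr
        exact encard_int_abs_le (by positivity)
    _ = ENNReal.ofReal (24 * T ^ 2) := by
        rw [← ENNReal.ofReal_mul (by positivity)]
        congr 1
        field_simp
        ring

/-! ### Moments of the number of near returns -/

/-- The points off the first axis with coordinates of greatest common divisor `k` that give
lattice vectors in a square. -/
def gcdLayer (w : (ℝ × ℝ) × (ℝ × ℝ)) (R : ℝ) (k : ℕ) : Set (ℤ × ℤ) :=
  {v | v.2 ≠ 0 ∧ Int.gcd v.1 v.2 = k ∧ ‖latVec w v‖ ≤ R}

lemma gcdLayer_zero (w : (ℝ × ℝ) × (ℝ × ℝ)) (R : ℝ) : gcdLayer w R 0 = ∅ := by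
  ext v
  simp only [gcdLayer, mem_ofPred_eq, mem_empty_iff_false, iff_false]
  rintro ⟨h, h1, -⟩
  exact h (Int.gcd_eq_zero_iff.1 h1).2

/-- Division by `k` maps the layer injectively into the lattice points of the square of radius `R /
k`. For `k = 0` the layer is empty and `R / 0 = 0`. -/
lemma encard_gcdLayer_le {w : (ℝ × ℝ) × (ℝ × ℝ)} (hw : det₂ w = 1) (hs : ‖w.1‖ ^ 2 ≤ 2) {R : ℝ}
    (hR : 0 ≤ R) (k : ℕ) :
    ((gcdLayer w R k).encard : ℝ≥0∞) ≤ ENNReal.ofReal (24 * (R / k) ^ 2) := by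
  rcases Nat.eq_zero_or_pos k with rfl | hk
  · simp [gcdLayer_zero]
  have hk' : (0 : ℝ) < k := by exact_mod_cast hk
  refine le_trans (ENat.toENNReal_le.2 ?_) (encard_latVec_le hw hs (div_nonneg hR hk'.le))
  refine (encard_le_encard (t := (fun v : ℤ × ℤ => ((k : ℤ) * v.1, (k : ℤ) * v.2)) '' _) ?_).trans
    (encard_image_le _ _)
  rintro ⟨a, b⟩ ⟨hb, hg, hv⟩
  simp only at hb hg
  obtain ⟨a', ha'⟩ : (k : ℤ) ∣ a := hg ▸ Int.gcd_dvd_left a b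
  obtain ⟨b', hb'⟩ : (k : ℤ) ∣ b := hg ▸ Int.gcd_dvd_right a b
  refine ⟨(a', b'), ⟨fun h => hb (by rw [hb', show b' = 0 from h, mul_zero]), ?_⟩, Prod.ext ha'.symm hb'.symm⟩
  have : latVec w (a, b) = (k : ℝ) • latVec w (a', b') := by
    simp only [latVec, smul_add, smul_smul, ha', hb']
    push_cast
    rfl
  rw [this, norm_smul, Real.norm_natCast] at hv
  rw [le_div_iff₀ hk']
  linarith

/-- Parallel integer vectors with the same gcd differ by a sign: if `a d = b c`, then `gcd(b c, b d)
= |b| k` and `gcd(a d, b d) = k |d|` coincide. -/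
lemma gcdLayer_independent (w : (ℝ × ℝ) × (ℝ × ℝ)) (R : ℝ) (k : ℕ) :
    ∀ u ∈ gcdLayer w R k, ∀ v ∈ gcdLayer w R k,
      v = u ∨ v = -u ∨ u.1 * v.2 - u.2 * v.1 ≠ 0 := by
  rintro ⟨a, b⟩ ⟨hb, hg, -⟩ ⟨c, d⟩ ⟨hd, hg', -⟩
  simp only at *
  by_cases h : a * d - b * c = 0
  · have h' : a * d = b * c := sub_eq_zero.1 h
    have hk : 0 < k := hg ▸ Int.gcd_pos_of_ne_zero_right a hb
    have h1 : Int.gcd (b * c) (b * d) = b.natAbs * k := by rw [Int.gcd_mul_left, hg']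
    have h2 : Int.gcd (a * d) (b * d) = k * d.natAbs := by rw [Int.gcd_mul_right, hg]
    rw [h'] at h2
    have h3 : b.natAbs = d.natAbs := by
      refine Nat.eq_of_mul_eq_mul_right hk ?_
      rw [← h1, h2, mul_comm]
    rcases Int.natAbs_eq_natAbs_iff.1 h3 with rfl | rfl
    · left
      have : a = c := mul_right_cancel₀ hd (by rw [h', mul_comm])
      rw [this]
    · right; left
      have : a = -c := mul_right_cancel₀ hd (by rw [h']; ring)
      simp [this]
  · exact Or.inr (Or.inr h)

/-- With `m = 48 ε R² / k²` bounding the mean, the second moment is at most `m² + 2m`. Since `1 / k²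
≤ 1` (also for `k = 0`, where it is `0`), a single factor `1 / k²` can be taken out of both terms;
`2304 = 48²`. -/
lemma lintegral_returnCount_gcdLayer_le {p : ℝ} (hp1 : 1 ≤ p) (hp2 : p ≤ 2)
    {w : (ℝ × ℝ) × (ℝ × ℝ)} (hw : det₂ w = 1) (hs : ‖w.1‖ ^ 2 ≤ 2) {R ε : ℝ}
    (hR : 0 ≤ R) (hε : 0 ≤ ε) (k : ℕ) :
    ∫⁻ t, returnCount ε (gcdLayer w R k) t ^ p ≤
      ENNReal.ofReal (2304 * (ε * R ^ 2 + (ε * R ^ 2) ^ 2)) * ENNReal.ofReal (1 / (k : ℝ) ^ 2) := by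
  have hE : ((gcdLayer w R k).encard : ℝ≥0∞) * ENNReal.ofReal (2 * ε) ≤
      ENNReal.ofReal (48 * (ε * R ^ 2) * (1 / (k : ℝ) ^ 2)) := by
    refine (mul_le_mul_left (encard_gcdLayer_le hw hs hR k) _).trans (le_of_eq ?_)
    rw [← ENNReal.ofReal_mul (by positivity)]
    congr 1
    rw [div_pow]
    ring
  have hk : 1 / (k : ℝ) ^ 2 ≤ 1 := by
    rcases Nat.eq_zero_or_pos k with rfl | hk
    · norm_num
    · rw [div_le_one (by positivity)]
      exact one_le_pow₀ (by exact_mod_cast hk)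
  have hk0 : 0 ≤ 1 / (k : ℝ) ^ 2 := by positivity
  calc ∫⁻ t, returnCount ε (gcdLayer w R k) t ^ p
      ≤ ∫⁻ t, returnCount ε (gcdLayer w R k) t ^ 2 :=
        lintegral_mono fun t => returnCount_rpow_le_sq hp1 hp2 t
    _ ≤ _ := lintegral_returnCount_sq_le ε (fun h => h.1 rfl) (gcdLayer_independent w R k)
    _ ≤ ENNReal.ofReal (48 * (ε * R ^ 2) * (1 / (k : ℝ) ^ 2)) ^ 2 +
        2 * ENNReal.ofReal (48 * (ε * R ^ 2) * (1 / (k : ℝ) ^ 2)) := by gcongr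
    _ ≤ _ := by
        rw [← ENNReal.ofReal_ofNat 2, ← ENNReal.ofReal_pow (by positivity),
          ← ENNReal.ofReal_mul (by positivity), ← ENNReal.ofReal_mul (by positivity),
          ← ENNReal.ofReal_add (by positivity) (by positivity)]
        refine ENNReal.ofReal_le_ofReal ?_
        set X := ε * R ^ 2
        have hX : 0 ≤ X := by positivity
        set y := 1 / (k : ℝ) ^ 2
        have h1 : X ^ 2 * y ^ 2 ≤ X ^ 2 * y :=
          mul_le_mul_of_nonneg_left (by nlinarith) (sq_nonneg X)
        have h2 : 0 ≤ X * y := by positivity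
        nlinarith

/-- Minkowski's inequality for a series of nonnegative functions. -/
lemma lintegral_tsum_rpow_le {α : Type*} [MeasurableSpace α] (μ : Measure α) {p : ℝ} (hp : 1 ≤ p)
    {f : ℕ → α → ℝ≥0∞} (hf : ∀ k, Measurable (f k)) :
    ∫⁻ t, (∑' k, f k t) ^ p ∂μ ≤ (∑' k, (∫⁻ t, f k t ^ p ∂μ) ^ (1 / p)) ^ p := by
  have hp0 : 0 < p := by linarith
  have hfin : ∀ n, ∫⁻ t, (∑ k ∈ Finset.range n, f k t) ^ p ∂μ ≤
      (∑' k, (∫⁻ t, f k t ^ p ∂μ) ^ (1 / p)) ^ p := by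
    intro n
    have : (∫⁻ t, (∑ k ∈ Finset.range n, f k t) ^ p ∂μ) ^ (1 / p) ≤
        ∑ k ∈ Finset.range n, (∫⁻ t, f k t ^ p ∂μ) ^ (1 / p) := by
      induction n with
      | zero => simp [ENNReal.zero_rpow_of_pos hp0, hp0]
      | succ n ih =>
        simp_rw [Finset.sum_range_succ]
        refine le_trans ?_ (add_le_add_left ih _)
        exact ENNReal.lintegral_Lp_add_le
          (Finset.measurable_fun_sum _ fun k _ => hf k).aemeasurable (hf n).aemeasurable hp
    rw [← ENNReal.rpow_le_rpow_iff (z := 1 / p) (by positivity), ← ENNReal.rpow_mul,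
      mul_one_div_cancel hp0.ne', ENNReal.rpow_one]
    exact this.trans (ENNReal.sum_le_tsum _)
  have hsup : ∀ t, (∑' k, f k t) ^ p = ⨆ n, (∑ k ∈ Finset.range n, f k t) ^ p := fun t => by
    rw [ENNReal.tsum_eq_iSup_nat]
    exact (ENNReal.orderIsoRpow p hp0).map_iSup _
  simp_rw [hsup]
  rw [lintegral_iSup (fun n => (Finset.measurable_fun_sum _ fun k _ => hf k).pow_const p)]
  · exact iSup_le hfin
  · intro m n hmn t
    simp only
    gcongr

/-- The exponent `2 / p` exceeds one exactly when `p < 2`. -/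
lemma tsum_one_div_sq_rpow_ne_top {p : ℝ} (hp1 : 1 ≤ p) (hp2 : p < 2) :
    ∑' k : ℕ, ENNReal.ofReal (1 / (k : ℝ) ^ 2) ^ (1 / p) ≠ ∞ := by
  have hs : Summable fun k : ℕ => 1 / (k : ℝ) ^ (2 / p) :=
    Real.summable_one_div_nat_rpow.2 (by rw [lt_div_iff₀ (by linarith)]; linarith)
  have : ∀ k : ℕ, ENNReal.ofReal (1 / (k : ℝ) ^ 2) ^ (1 / p) =
      ENNReal.ofReal (1 / (k : ℝ) ^ (2 / p)) := by
    intro k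
    rw [ENNReal.ofReal_rpow_of_nonneg (by positivity) (by positivity)]
    congr 1
    rw [Real.div_rpow zero_le_one (by positivity), Real.one_rpow, ← Real.rpow_natCast,
      ← Real.rpow_mul (by positivity)]
    congr 2
    push_cast
    ring
  simp_rw [this]
  exact hs.tsum_ofReal_ne_top

/-- The nonzero integer points that give lattice vectors in a square. -/
def squarePoints (w : (ℝ × ℝ) × (ℝ × ℝ)) (R : ℝ) : Set (ℤ × ℤ) := {v | v ≠ 0 ∧ ‖latVec w v‖ ≤ R}

/-- Points of `squarePoints` on the first axis. -/
def axisPoints (w : (ℝ × ℝ) × (ℝ × ℝ)) (R : ℝ) : Set (ℤ × ℤ) :=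
  (fun a : ℤ => ((a, 0) : ℤ × ℤ)) '' {a | a ≠ 0 ∧ |(a : ℝ)| ≤ R / ‖w.1‖}

lemma zero_notMem_axisPoints (w : (ℝ × ℝ) × (ℝ × ℝ)) (R : ℝ) : 0 ∉ axisPoints w R := by
  rintro ⟨a, ⟨ha, -⟩, h⟩
  exact ha (congrArg Prod.fst h)

lemma squarePoints_subset {w : (ℝ × ℝ) × (ℝ × ℝ)} (hw : det₂ w = 1) (R : ℝ) :
    squarePoints w R ⊆ axisPoints w R ∪ ⋃ k, gcdLayer w R k := by
  rintro ⟨a, b⟩ ⟨hv, hn⟩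
  by_cases hb : b = 0
  · subst hb
    refine Or.inl ⟨a, ⟨fun h => hv (by rw [h]; rfl), ?_⟩, rfl⟩
    rw [le_div_iff₀ (norm_fst_pos (by rw [hw]; exact one_pos))]
    simpa [latVec, norm_smul] using hn
  · exact Or.inr (mem_iUnion.2 ⟨_, hb, rfl, hn⟩)

lemma returnCount_squarePoints_le {w : (ℝ × ℝ) × (ℝ × ℝ)} (hw : det₂ w = 1) (R ε : ℝ) (t) :
    returnCount ε (squarePoints w R) t ≤
      returnCount ε (axisPoints w R) t + ∑' k, returnCount ε (gcdLayer w R k) t := by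
  set F : ℤ × ℤ → ℝ≥0∞ := fun v => (nearReturn ε v).indicator 1 t
  calc ∑' v : squarePoints w R, F v
      ≤ ∑' v : ↑(axisPoints w R ∪ ⋃ k, gcdLayer w R k), F v :=
        ENNReal.tsum_mono_subtype F (squarePoints_subset hw R)
    _ ≤ ∑' v : axisPoints w R, F v + ∑' v : ⋃ k, gcdLayer w R k, F v :=
        ENNReal.tsum_union_le F _ _
    _ ≤ _ := add_le_add le_rfl (ENNReal.tsum_iUnion_le_tsum F _)

/-- Moments of order less than two of the number of near returns. -/
lemma exists_lintegral_returnCount_le {p : ℝ} (hp1 : 1 ≤ p) (hp2 : p < 2) :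
    ∃ K : ℝ≥0∞, K ≠ ∞ ∧ ∀ w : (ℝ × ℝ) × (ℝ × ℝ), det₂ w = 1 → ‖w.1‖ ^ 2 ≤ 2 →
      ∀ R ε : ℝ, 0 ≤ R → 0 ≤ ε →
      ∫⁻ t, returnCount ε (squarePoints w R) t ^ p ≤
        K * (ENNReal.ofReal (ε * (R / ‖w.1‖) ^ p) +
          ENNReal.ofReal (ε * R ^ 2 + (ε * R ^ 2) ^ 2)) := by
  have hp0 : 0 < p := by linarith
  set Z := ∑' k : ℕ, ENNReal.ofReal (1 / (k : ℝ) ^ 2) ^ (1 / p)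
  have hZ : Z ≠ ∞ := tsum_one_div_sq_rpow_ne_top hp1 hp2
  set K₁ : ℝ≥0∞ := ENNReal.ofReal (2 ^ p * 2)
  set K₂ : ℝ≥0∞ := ENNReal.ofReal 2304 * Z ^ p
  have hK₂ : K₂ ≠ ∞ := ENNReal.mul_ne_top ENNReal.ofReal_ne_top
    (ENNReal.rpow_ne_top_of_nonneg hp0.le hZ)
  refine ⟨2 ^ (p - 1) * (K₁ + K₂), ENNReal.mul_ne_top
    (ENNReal.rpow_ne_top_of_nonneg (by linarith) (by simp))
    (ENNReal.add_ne_top.2 ⟨ENNReal.ofReal_ne_top, hK₂⟩), ?_⟩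
  intro w hw hs R ε hR hε
  have hr : 0 < ‖w.1‖ := norm_fst_pos (by rw [hw]; exact one_pos)
  have hX : 0 ≤ ε * R ^ 2 := by positivity
  -- Axis points are all parallel, so no independence is available; the trivial bound on the count
  -- is used instead.
  have h1 : ∫⁻ t, returnCount ε (axisPoints w R) t ^ p ≤
      K₁ * ENNReal.ofReal (ε * (R / ‖w.1‖) ^ p) := by
    refine (lintegral_returnCount_rpow_le_of_encard ε hp1 (zero_notMem_axisPoints w R)).trans ?_
    have : ((axisPoints w R).encard : ℝ≥0∞) ≤ ENNReal.ofReal (2 * (R / ‖w.1‖)) :=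
      (ENat.toENNReal_le.2 (encard_image_le _ _)).trans (encard_int_abs_le (by positivity))
    calc ((axisPoints w R).encard : ℝ≥0∞) ^ p * ENNReal.ofReal (2 * ε)
        ≤ ENNReal.ofReal (2 * (R / ‖w.1‖)) ^ p * ENNReal.ofReal (2 * ε) := by gcongr
      _ = _ := by
        rw [ENNReal.ofReal_rpow_of_nonneg (by positivity) hp0.le,
          ← ENNReal.ofReal_mul (by positivity), ← ENNReal.ofReal_mul (by positivity),
          Real.mul_rpow (by positivity) (by positivity)]
        congr 1
        ring
  have h2 : ∫⁻ t, (∑' k, returnCount ε (gcdLayer w R k) t) ^ p ≤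
      K₂ * ENNReal.ofReal (ε * R ^ 2 + (ε * R ^ 2) ^ 2) := by
    refine (lintegral_tsum_rpow_le volume hp1 fun k => measurable_returnCount ε _).trans ?_
    calc (∑' k, (∫⁻ t, returnCount ε (gcdLayer w R k) t ^ p) ^ (1 / p)) ^ p
        ≤ (∑' k : ℕ, ENNReal.ofReal (2304 * (ε * R ^ 2 + (ε * R ^ 2) ^ 2)) ^ (1 / p) *
            ENNReal.ofReal (1 / (k : ℝ) ^ 2) ^ (1 / p)) ^ p := by
          gcongr with k
          rw [← ENNReal.mul_rpow_of_nonneg _ _ (by positivity)]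
          gcongr
          exact lintegral_returnCount_gcdLayer_le hp1 hp2.le hw hs hR hε k
      _ = ENNReal.ofReal (2304 * (ε * R ^ 2 + (ε * R ^ 2) ^ 2)) * Z ^ p := by
          rw [ENNReal.tsum_mul_left, ENNReal.mul_rpow_of_nonneg _ _ hp0.le, ← ENNReal.rpow_mul,
            one_div_mul_cancel hp0.ne', ENNReal.rpow_one]
      _ = _ := by
          rw [ENNReal.ofReal_mul (by norm_num)]
          ring
  calc ∫⁻ t, returnCount ε (squarePoints w R) t ^ p
      ≤ ∫⁻ t, 2 ^ (p - 1) * (returnCount ε (axisPoints w R) t ^ p +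
          (∑' k, returnCount ε (gcdLayer w R k) t) ^ p) := by
        refine lintegral_mono fun t => ?_
        refine le_trans ?_ (ENNReal.rpow_add_le_mul_rpow_add_rpow _ _ hp1)
        exact ENNReal.rpow_le_rpow (returnCount_squarePoints_le hw R ε t) hp0.le
    _ = 2 ^ (p - 1) * ((∫⁻ t, returnCount ε (axisPoints w R) t ^ p) +
          ∫⁻ t, (∑' k, returnCount ε (gcdLayer w R k) t) ^ p) := by
        have hm := (measurable_returnCount ε (axisPoints w R)).pow_const p
        rw [← lintegral_add_left hm, lintegral_const_mul]
        exact hm.add ((Measurable.tsum fun k => measurable_returnCount ε _).pow_const p)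
    _ ≤ 2 ^ (p - 1) * (K₁ * ENNReal.ofReal (ε * (R / ‖w.1‖) ^ p) +
          K₂ * ENNReal.ofReal (ε * R ^ 2 + (ε * R ^ 2) ^ 2)) := by gcongr
    _ ≤ _ := by
        rw [mul_assoc (2 ^ (p - 1)) (K₁ + K₂), mul_add (K₁ + K₂)]
        gcongr
        · exact le_self_add
        · exact le_add_self

/-! ### Block coordinates on the stabilizer of a basis vector -/

section Block

variable {R : Type*} [CommRing R]

/-- The product of the matrix with columns `w` and the vector `v`. -/
def mulVec₂ (w : (R × R) × (R × R)) (v : R × R) : R × R :=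
  (w.1.1 * v.1 + w.2.1 * v.2, w.1.2 * v.1 + w.2.2 * v.2)

/-- The product of two matrices given by their columns. -/
def mul₂ (w w' : (R × R) × (R × R)) : (R × R) × (R × R) := (mulVec₂ w w'.1, mulVec₂ w w'.2)

/-- The product of the row vector `u` and the matrix with columns `w`. -/
def vecMul₂ (u : R × R) (w : (R × R) × (R × R)) : R × R :=
  (u.1 * w.1.1 + u.2 * w.1.2, u.1 * w.2.1 + u.2 * w.2.2)

lemma det₂_mul₂ (w w' : (R × R) × (R × R)) : det₂ (mul₂ w w') = det₂ w * det₂ w' := by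
  simp only [det₂, mul₂, mulVec₂]
  ring

lemma det₂_smul (r : R) (w : (R × R) × (R × R)) : det₂ (r • w) = r ^ 2 * det₂ w := by
  simp only [det₂, Prod.smul_fst, Prod.smul_snd, smul_eq_mul]
  ring

lemma mul₂_smul (r : R) (w w' : (R × R) × (R × R)) : mul₂ w (r • w') = r • mul₂ w w' := by
  ext <;> simp only [mul₂, mulVec₂, Prod.smul_fst, Prod.smul_snd, smul_eq_mul] <;> ring

lemma smul_mul₂ (r : R) (w w' : (R × R) × (R × R)) : mul₂ (r • w) w' = r • mul₂ w w' := by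
  ext <;> simp only [mul₂, mulVec₂, Prod.smul_fst, Prod.smul_snd, smul_eq_mul] <;> ring

/-- The matrix with rows `(1, u)` and `(0, w)`. -/
def blockMatrix (w : (R × R) × (R × R)) (u : R × R) : Matrix (Fin 3) (Fin 3) R :=
  !![1, u.1, u.2; 0, w.1.1, w.2.1; 0, w.1.2, w.2.2]

lemma det_blockMatrix (w : (R × R) × (R × R)) (u : R × R) : (blockMatrix w u).det = det₂ w := by
  simp [blockMatrix, Matrix.det_fin_three, det₂]

lemma blockMatrix_mul (w w' : (R × R) × (R × R)) (u u' : R × R) :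
    blockMatrix w u * blockMatrix w' u' = blockMatrix (mul₂ w w') (u' + vecMul₂ u w') := by
  ext i j
  fin_cases i <;> fin_cases j <;>
    simp [blockMatrix, Matrix.mul_apply, Fin.sum_univ_three, mul₂, mulVec₂, vecMul₂] <;> ring

lemma map_blockMatrix {S : Type*} [CommRing S] (f : R →+* S) (w : (R × R) × (R × R)) (u : R × R) :
    (blockMatrix w u).map f =
      blockMatrix ((f w.1.1, f w.1.2), (f w.2.1, f w.2.2)) (f u.1, f u.2) := by
  ext i j
  fin_cases i <;> fin_cases j <;> simp [blockMatrix]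

/-- The matrix `blockMatrix w u` in permuted coordinates, as an element of `SL(3, R)`. -/
def blockSL (σ : Equiv.Perm (Fin 3)) (w : (R × R) × (R × R)) (u : R × R) (hw : det₂ w = 1) :
    SL(3, R) :=
  ⟨(blockMatrix w u).submatrix σ σ, by
    rw [Matrix.det_submatrix_equiv_self, det_blockMatrix, hw]⟩

lemma blockSL_mul (σ : Equiv.Perm (Fin 3)) {w w' : (R × R) × (R × R)} (u u' : R × R)
    (hw : det₂ w = 1) (hw' : det₂ w' = 1) :
    blockSL σ w u hw * blockSL σ w' u' hw' =
      blockSL σ (mul₂ w w') (u' + vecMul₂ u w') (by rw [det₂_mul₂, hw, hw', one_mul]) := by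
  apply Subtype.ext
  change (blockMatrix w u).submatrix σ σ * (blockMatrix w' u').submatrix σ σ = _
  rw [Matrix.submatrix_mul_equiv, blockMatrix_mul]
  rfl

end Block

variable {σ : Equiv.Perm (Fin 3)} {j : Fin 3}

/-- The permutation `σ` moves the fixed column to position `0`, so one argument serves both
stabilizers. -/
lemma blockSL_mem_fixCol (hσ : σ j = 0) (w : (ℝ × ℝ) × (ℝ × ℝ)) (u : ℝ × ℝ) (hw : det₂ w = 1) :
    blockSL σ w u hw ∈ fixCol j := by
  intro i
  change blockMatrix w u (σ i) (σ j) = _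
  have h1 : (1 : Matrix (Fin 3) (Fin 3) ℝ) i j = (1 : Matrix (Fin 3) (Fin 3) ℝ) (σ i) (σ j) := by
    simp [Matrix.one_apply]
  rw [h1, hσ]
  generalize σ i = k
  fin_cases k <;> simp [blockMatrix, Matrix.one_apply]

/-- The element of `fixCol j` with the given block coordinates. -/
def fixColElt (hσ : σ j = 0) (w : (ℝ × ℝ) × (ℝ × ℝ)) (u : ℝ × ℝ) (hw : det₂ w = 1) : fixCol j :=
  ⟨blockSL σ w u hw, blockSL_mem_fixCol hσ w u hw⟩

lemma fixColElt_mul (hσ : σ j = 0) {w w' : (ℝ × ℝ) × (ℝ × ℝ)} (u u' : ℝ × ℝ)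
    (hw : det₂ w = 1) (hw' : det₂ w' = 1) :
    fixColElt hσ w u hw * fixColElt hσ w' u' hw' =
      fixColElt hσ (mul₂ w w') (u' + vecMul₂ u w') (by rw [det₂_mul₂, hw, hw', one_mul]) :=
  Subtype.ext (blockSL_mul σ u u' hw hw')

lemma fixColElt_congr (hσ : σ j = 0) {w w' : (ℝ × ℝ) × (ℝ × ℝ)} {u u' : ℝ × ℝ}
    (hw : det₂ w = 1) (h1 : w = w') (h2 : u = u') :
    fixColElt hσ w u hw = fixColElt hσ w' u' (h1 ▸ hw) := by
  subst h1 h2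
  rfl

/-- The entries of a matrix of `fixCol j`, in block coordinates. -/
def blockW (σ : Equiv.Perm (Fin 3)) (h : SL(3, ℝ)) : (ℝ × ℝ) × (ℝ × ℝ) :=
  ((h.1 (σ.symm 1) (σ.symm 1), h.1 (σ.symm 2) (σ.symm 1)),
    (h.1 (σ.symm 1) (σ.symm 2), h.1 (σ.symm 2) (σ.symm 2)))

/-- The entries of the row of a matrix of `fixCol j` through its fixed column. -/
def blockU (σ : Equiv.Perm (Fin 3)) (h : SL(3, ℝ)) : ℝ × ℝ :=
  (h.1 (σ.symm 0) (σ.symm 1), h.1 (σ.symm 0) (σ.symm 2))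

lemma blockW_blockSL (σ : Equiv.Perm (Fin 3)) (w : (ℝ × ℝ) × (ℝ × ℝ)) (u : ℝ × ℝ)
    (hw : det₂ w = 1) : blockW σ (blockSL σ w u hw) = w := by
  simp [blockW, blockSL, blockMatrix]

lemma blockU_blockSL (σ : Equiv.Perm (Fin 3)) (w : (ℝ × ℝ) × (ℝ × ℝ)) (u : ℝ × ℝ)
    (hw : det₂ w = 1) : blockU σ (blockSL σ w u hw) = u := by
  simp [blockU, blockSL, blockMatrix]

lemma val_eq_blockMatrix (hσ : σ j = 0) (h : fixCol j) :
    h.1.1 = (blockMatrix (blockW σ h.1) (blockU σ h.1)).submatrix σ σ := by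
  have hj : j = σ.symm 0 := by rw [← hσ, Equiv.symm_apply_apply]
  have hcol : ∀ k, h.1.1 (σ.symm k) (σ.symm 0) = (1 : Matrix (Fin 3) (Fin 3) ℝ) k 0 := by
    intro k
    rw [← hj, h.2 (σ.symm k), Matrix.one_apply, Matrix.one_apply, hj]
    simp
  have : h.1.1.submatrix σ.symm σ.symm = blockMatrix (blockW σ h.1) (blockU σ h.1) := by
    ext a b
    fin_cases a <;> fin_cases b <;> simp [blockMatrix, blockW, blockU, hcol]
  rw [← this]
  simp

lemma det₂_blockW (hσ : σ j = 0) (h : fixCol j) : det₂ (blockW σ h.1) = 1 := by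
  have h1 := h.1.2
  rw [val_eq_blockMatrix hσ h, Matrix.det_submatrix_equiv_self, det_blockMatrix] at h1
  exact h1

lemma eq_fixColElt (hσ : σ j = 0) (h : fixCol j) :
    h = fixColElt hσ (blockW σ h.1) (blockU σ h.1) (det₂_blockW hσ h) :=
  Subtype.ext (Subtype.ext (val_eq_blockMatrix hσ h))

/-! ### Linear maps of determinant one preserve the volume -/

lemma measurePreserving_mulVec₂ {w : (ℝ × ℝ) × (ℝ × ℝ)} (hw : det₂ w = 1) :
    MeasurePreserving (mulVec₂ w) := by
  set f := Matrix.toLin (Module.Basis.finTwoProd ℝ) (Module.Basis.finTwoProd ℝ)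
    !![w.1.1, w.2.1; w.1.2, w.2.2]
  have hf : ⇑f = mulVec₂ w := funext fun v => Matrix.toLin_finTwoProd_apply _ _ _ _ v
  have hdet : LinearMap.det f = 1 := by
    rw [LinearMap.det_toLin, Matrix.det_fin_two_of]
    exact hw
  rw [← hf]
  refine ⟨f.continuous_of_finiteDimensional.measurable, ?_⟩
  rw [Measure.map_linearMap_addHaar_eq_smul_addHaar _ (by rw [hdet]; exact one_ne_zero), hdet]
  simp

/-- Transposition of a matrix. -/
def transpose₂ (w : (ℝ × ℝ) × (ℝ × ℝ)) : (ℝ × ℝ) × (ℝ × ℝ) := ((w.1.1, w.2.1), (w.1.2, w.2.2))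

/-- Transposition swaps the two middle ones of four real coordinates; the rest is reassociation of
products. -/
lemma measurePreserving_transpose₂ : MeasurePreserving transpose₂ := by
  have hid := MeasurePreserving.id (volume : Measure ℝ)
  have h1 : MeasurePreserving (fun x : (ℝ × ℝ) × (ℝ × ℝ) => (x.1.1, x.1.2, x.2)) :=
    measurePreserving_prodAssoc volume volume volume
  have h2 : MeasurePreserving (fun x : ℝ × ℝ × (ℝ × ℝ) => ((x.1, x.2.1), x.2.2)) :=
    (measurePreserving_prodAssoc (volume : Measure ℝ) (volume : Measure ℝ)
      (volume : Measure (ℝ × ℝ))).symm MeasurableEquiv.prodAssoc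
  have h3 : MeasurePreserving (fun x : ℝ × ℝ × ℝ => (x.2.1, x.1, x.2.2)) := by
    have a1 : MeasurePreserving (fun x : ℝ × ℝ × ℝ => ((x.1, x.2.1), x.2.2)) :=
      (measurePreserving_prodAssoc (volume : Measure ℝ) (volume : Measure ℝ)
        (volume : Measure ℝ)).symm MeasurableEquiv.prodAssoc
    have a2 : MeasurePreserving (fun x : (ℝ × ℝ) × ℝ => ((x.1.2, x.1.1), x.2)) :=
      (Measure.measurePreserving_swap (μ := (volume : Measure ℝ))
        (ν := (volume : Measure ℝ))).prod hid
    have a3 : MeasurePreserving (fun x : (ℝ × ℝ) × ℝ => (x.1.1, x.1.2, x.2)) :=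
      measurePreserving_prodAssoc volume volume volume
    exact a3.comp (a2.comp a1)
  exact h2.comp ((hid.prod h3).comp h1)

lemma measurePreserving_mul₂_left {w : (ℝ × ℝ) × (ℝ × ℝ)} (hw : det₂ w = 1) :
    MeasurePreserving (mul₂ w) :=
  (measurePreserving_mulVec₂ hw).prod (measurePreserving_mulVec₂ hw)

lemma measurePreserving_mul₂_right {w : (ℝ × ℝ) × (ℝ × ℝ)} (hw : det₂ w = 1) :
    MeasurePreserving (fun x => mul₂ x w) := by
  have hw' : det₂ (transpose₂ w) = 1 := by
    rw [← hw]
    simp only [det₂, transpose₂]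
    ring
  have h := measurePreserving_transpose₂.comp
    ((measurePreserving_mul₂_left hw').comp measurePreserving_transpose₂)
  convert h using 1
  funext x
  ext <;> simp only [mul₂, mulVec₂, transpose₂, Function.comp] <;> ring

lemma measurePreserving_vecMul₂ {w : (ℝ × ℝ) × (ℝ × ℝ)} (hw : det₂ w = 1) :
    MeasurePreserving (fun u => vecMul₂ u w) := by
  have hw' : det₂ (transpose₂ w) = 1 := by
    rw [← hw]
    simp only [det₂, transpose₂]
    ring
  convert measurePreserving_mulVec₂ hw' using 1
  funext u
  ext <;> simp only [vecMul₂, mulVec₂, transpose₂] <;> ring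

/-! ### Haar measure on the stabilizer of a basis vector -/

lemma continuous_det₂ : Continuous (det₂ : (ℝ × ℝ) × (ℝ × ℝ) → ℝ) := by
  unfold det₂
  fun_prop

/-- The parameter domain: matrices of determinant in `(0, 1]` together with row vectors. -/
def coneDomain : Set (((ℝ × ℝ) × (ℝ × ℝ)) × (ℝ × ℝ)) := {x | 0 < det₂ x.1 ∧ det₂ x.1 ≤ 1}

lemma measurableSet_coneDomain : MeasurableSet coneDomain := by
  have h : Measurable fun x : ((ℝ × ℝ) × (ℝ × ℝ)) × (ℝ × ℝ) => det₂ x.1 :=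
    (continuous_det₂.comp continuous_fst).measurable
  exact (measurableSet_lt measurable_const h).inter (measurableSet_le h measurable_const)

/-- The matrix `w`, scaled to determinant one. -/
noncomputable def unimod (w : (ℝ × ℝ) × (ℝ × ℝ)) : (ℝ × ℝ) × (ℝ × ℝ) := (√(det₂ w))⁻¹ • w

lemma det₂_unimod {w : (ℝ × ℝ) × (ℝ × ℝ)} (hw : 0 < det₂ w) : det₂ (unimod w) = 1 := by
  rw [unimod, det₂_smul, inv_pow, Real.sq_sqrt hw.le, inv_mul_cancel₀ hw.ne']

lemma unimod_mul₂_left {w w' : (ℝ × ℝ) × (ℝ × ℝ)} (hw : det₂ w = 1) :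
    unimod (mul₂ w w') = mul₂ w (unimod w') := by
  rw [unimod, det₂_mul₂, hw, one_mul, unimod, mul₂_smul]

lemma unimod_mul₂_right {w w' : (ℝ × ℝ) × (ℝ × ℝ)} (hw' : det₂ w' = 1) :
    unimod (mul₂ w w') = mul₂ (unimod w) w' := by
  rw [unimod, det₂_mul₂, hw', mul_one, unimod, smul_mul₂]

open scoped Classical in
/-- Parametrization of `fixCol j`. -/
noncomputable def coneMap (hσ : σ j = 0) (x : ((ℝ × ℝ) × (ℝ × ℝ)) × (ℝ × ℝ)) : fixCol j :=
  if h : 0 < det₂ x.1 then fixColElt hσ (unimod x.1) x.2 (det₂_unimod h) else 1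

lemma coneMap_of_pos (hσ : σ j = 0) {x : ((ℝ × ℝ) × (ℝ × ℝ)) × (ℝ × ℝ)} (h : 0 < det₂ x.1) :
    coneMap hσ x = fixColElt hσ (unimod x.1) x.2 (det₂_unimod h) := dif_pos h

/-- The entries of a matrix, as a function of two variables. -/
def entries (g : SL(3, ℝ)) : Fin 3 → Fin 3 → ℝ := g.1

lemma isClosedEmbedding_entries : Topology.IsClosedEmbedding entries :=
  Matrix.SpecialLinearGroup.isClosedEmbedding_val (n := Fin 3) (R := ℝ)

lemma continuous_entry (i k : Fin 3) : Continuous fun g : SL(3, ℝ) => g.1 i k :=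
  (continuous_apply_apply i k).comp isClosedEmbedding_entries.continuous

lemma measurable_of_entries {α : Type*} [MeasurableSpace α] {g : α → SL(3, ℝ)}
    (h : ∀ i k, Measurable fun x => (g x).1 i k) : Measurable g :=
  isClosedEmbedding_entries.measurableEmbedding.measurable_comp_iff.1
    (measurable_pi_lambda _ fun i => measurable_pi_lambda _ fun k => h i k)

lemma measurable_unimod : Measurable unimod := by
  unfold unimod
  have := continuous_det₂.measurable
  fun_prop

lemma measurable_blockMatrix_apply (i k : Fin 3) :
    Measurable fun x : ((ℝ × ℝ) × (ℝ × ℝ)) × (ℝ × ℝ) => blockMatrix x.1 x.2 i k := by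
  fin_cases i <;> fin_cases k <;> simp [blockMatrix] <;> fun_prop

lemma measurable_coneMap (hσ : σ j = 0) : Measurable (coneMap hσ) := by
  classical
  refine Measurable.subtype_mk (measurable_of_entries fun i k => ?_)
  have hd : MeasurableSet {x : ((ℝ × ℝ) × (ℝ × ℝ)) × (ℝ × ℝ) | 0 < det₂ x.1} :=
    measurableSet_lt measurable_const (continuous_det₂.comp continuous_fst).measurable
  have heq : (fun x => ((coneMap hσ x : fixCol j) : SL(3, ℝ)).1 i k) = fun x =>
      if 0 < det₂ x.1 then
        blockMatrix (unimod x.1) x.2 (σ i) (σ k) else (1 : SL(3, ℝ)).1 i k := by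
    funext x
    by_cases h : 0 < det₂ x.1
    · simp only [if_pos h, coneMap_of_pos hσ h]
      rfl
    · simp only [if_neg h, coneMap, dif_neg h]
      rfl
  change Measurable (fun x => ((coneMap hσ x : fixCol j) : SL(3, ℝ)).1 i k)
  rw [heq]
  refine Measurable.ite hd ?_ measurable_const
  exact (measurable_blockMatrix_apply (σ i) (σ k)).comp
    ((measurable_unimod.comp measurable_fst).prodMk measurable_snd)

/-- The image of Lebesgue measure under the parametrization. -/
noncomputable def coneMeasure (hσ : σ j = 0) : Measure (fixCol j) :=
  (volume.restrict coneDomain).map (coneMap hσ)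

/-- Invariance under `F` follows once `F` lifts through the parametrization to a volume-preserving
map `T` that keeps the determinant, and hence the cone. -/
lemma coneMeasure_map_eq (hσ : σ j = 0) {F : fixCol j → fixCol j} (hF : Measurable F)
    {T : ((ℝ × ℝ) × (ℝ × ℝ)) × (ℝ × ℝ) → ((ℝ × ℝ) × (ℝ × ℝ)) × (ℝ × ℝ)}
    (hT : MeasurePreserving T) (hdet : ∀ x, det₂ (T x).1 = det₂ x.1)
    (hFT : ∀ x, 0 < det₂ x.1 → F (coneMap hσ x) = coneMap hσ (T x)) :
    (coneMeasure hσ).map F = coneMeasure hσ := by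
  have hpre : T ⁻¹' coneDomain = coneDomain := by
    ext x
    simp only [coneDomain, mem_preimage, mem_ofPred_eq, hdet]
  have hTr := hT.restrict_preimage measurableSet_coneDomain
  rw [hpre] at hTr
  rw [coneMeasure, Measure.map_map hF (measurable_coneMap hσ)]
  have hae : F ∘ coneMap hσ =ᵐ[volume.restrict coneDomain] coneMap hσ ∘ T := by
    filter_upwards [ae_restrict_mem measurableSet_coneDomain] with x hx
    exact hFT x hx.1
  rw [Measure.map_congr hae, ← Measure.map_map (measurable_coneMap hσ) hTr.measurable, hTr.map_eq]

/-- A skew product: the row vector is translated by an amount that depends only on the matrix. -/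
lemma measurePreserving_coneLeft {w : (ℝ × ℝ) × (ℝ × ℝ)} (hw : det₂ w = 1) (u : ℝ × ℝ) :
    MeasurePreserving (fun x : ((ℝ × ℝ) × (ℝ × ℝ)) × (ℝ × ℝ) =>
      (mul₂ w x.1, x.2 + vecMul₂ u (unimod x.1))) := by
  have hv : Measurable fun x : (ℝ × ℝ) × (ℝ × ℝ) => vecMul₂ u x := by
    unfold vecMul₂
    fun_prop
  refine MeasurePreserving.skew_product (measurePreserving_mul₂_left hw)
    (g := fun x y => y + vecMul₂ u (unimod x)) ?_ (Filter.Eventually.of_forall fun x => ?_)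
  · exact measurable_snd.add (hv.comp (measurable_unimod.comp measurable_fst))
  · exact (measurePreserving_add_right volume _).map_eq

lemma measurePreserving_coneRight {w : (ℝ × ℝ) × (ℝ × ℝ)} (hw : det₂ w = 1) (u : ℝ × ℝ) :
    MeasurePreserving (fun x : ((ℝ × ℝ) × (ℝ × ℝ)) × (ℝ × ℝ) =>
      (mul₂ x.1 w, u + vecMul₂ x.2 w)) :=
  (measurePreserving_mul₂_right hw).prod
    ((measurePreserving_add_left volume u).comp (measurePreserving_vecMul₂ hw))

lemma coneMeasure_map_mul_left (hσ : σ j = 0) (h : fixCol j) :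
    (coneMeasure hσ).map (h * ·) = coneMeasure hσ := by
  have hw := det₂_blockW hσ h
  refine coneMeasure_map_eq hσ (measurable_const_mul h)
    (measurePreserving_coneLeft hw (blockU σ h.1)) (fun x => ?_) fun x hx => ?_
  · rw [det₂_mul₂, hw, one_mul]
  · rw [coneMap_of_pos hσ hx, coneMap_of_pos hσ (by rwa [det₂_mul₂, hw, one_mul])]
    conv_lhs => rw [eq_fixColElt hσ h]
    rw [fixColElt_mul]
    exact fixColElt_congr hσ _ (unimod_mul₂_left hw).symm rfl

/-- Unimodularity of the stabilizer, needed because the integer points act from the right. -/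
lemma coneMeasure_map_mul_right (hσ : σ j = 0) (h : fixCol j) :
    (coneMeasure hσ).map (· * h) = coneMeasure hσ := by
  have hw := det₂_blockW hσ h
  refine coneMeasure_map_eq hσ (measurable_mul_const h)
    (measurePreserving_coneRight hw (blockU σ h.1)) (fun x => ?_) fun x hx => ?_
  · rw [det₂_mul₂, hw, mul_one]
  · rw [coneMap_of_pos hσ hx, coneMap_of_pos hσ (by rwa [det₂_mul₂, hw, mul_one])]
    conv_lhs => rw [eq_fixColElt hσ h]
    rw [fixColElt_mul]
    exact fixColElt_congr hσ _ (unimod_mul₂_right hw).symm rfl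

lemma coneMeasure_univ_ne_zero (hσ : σ j = 0) : coneMeasure hσ univ ≠ 0 := by
  rw [coneMeasure, Measure.map_apply (measurable_coneMap hσ) MeasurableSet.univ, preimage_univ,
    Measure.restrict_apply_univ]
  have hopen : IsOpen {x : ((ℝ × ℝ) × (ℝ × ℝ)) × (ℝ × ℝ) | 0 < det₂ x.1 ∧ det₂ x.1 < 1} := by
    have h : Continuous fun x : ((ℝ × ℝ) × (ℝ × ℝ)) × (ℝ × ℝ) => det₂ x.1 :=
      continuous_det₂.comp continuous_fst
    exact (isOpen_lt continuous_const h).inter (isOpen_lt h continuous_const)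
  have hne : {x : ((ℝ × ℝ) × (ℝ × ℝ)) × (ℝ × ℝ) | 0 < det₂ x.1 ∧ det₂ x.1 < 1}.Nonempty :=
    ⟨(((1, 0), (0, 1 / 2)), (0, 0)), by norm_num [det₂], by norm_num [det₂]⟩
  refine (lt_of_lt_of_le (hopen.measure_pos volume hne) (measure_mono ?_)).ne'
  exact fun x hx => ⟨hx.1, hx.2.le⟩

/-- On the cone the determinant is at most one, so scaling to determinant one only enlarges entries.
Hence compact sets have bounded preimages in the cone, and the cone measure is finite on them. -/
lemma norm_le_of_entries_le {x : ((ℝ × ℝ) × (ℝ × ℝ)) × (ℝ × ℝ)} {C : ℝ}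
    (hx : x ∈ coneDomain) (h : ∀ i k, |blockMatrix (unimod x.1) x.2 i k| ≤ C) : ‖x‖ ≤ C := by
  have hs : 0 < √(det₂ x.1) := Real.sqrt_pos.2 hx.1
  have hs1 : √(det₂ x.1) ≤ 1 := Real.sqrt_le_one.2 hx.2
  have key : ∀ r : ℝ, |(√(det₂ x.1))⁻¹ * r| ≤ C → |r| ≤ C := by
    intro r hr
    rw [abs_mul, abs_of_pos (inv_pos.2 hs), ← div_eq_inv_mul, div_le_iff₀ hs] at hr
    have hC : 0 ≤ C := by
      have := abs_nonneg r
      by_contra! hC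
      nlinarith
    nlinarith
  have h11 := key _ (h 1 1)
  have h12 := key _ (h 1 2)
  have h21 := key _ (h 2 1)
  have h22 := key _ (h 2 2)
  have h01 : |x.2.1| ≤ C := h 0 1
  have h02 : |x.2.2| ≤ C := h 0 2
  simp only [Prod.norm_def, Real.norm_eq_abs]
  exact max_le (max_le (max_le h11 h21) (max_le h12 h22)) (max_le h01 h02)

instance (hσ : σ j = 0) : IsFiniteMeasureOnCompacts (coneMeasure hσ) := by
  refine ⟨fun K hK => ?_⟩
  have hcont : Continuous fun g : fixCol j => entries g.1 :=
    isClosedEmbedding_entries.continuous.comp continuous_subtype_val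
  obtain ⟨C, hC⟩ := (hK.image hcont).isBounded.exists_norm_le
  have hent : ∀ g ∈ K, ∀ i k, |g.1.1 i k| ≤ C := fun g hg i k =>
    ((norm_le_pi_norm (entries g.1 i) k).trans
      (norm_le_pi_norm (entries g.1) i)).trans (hC _ ⟨g, hg, rfl⟩)
  rw [coneMeasure, Measure.map_apply (measurable_coneMap hσ) hK.measurableSet,
    Measure.restrict_apply (measurable_coneMap hσ hK.measurableSet)]
  refine lt_of_le_of_lt (measure_mono (t := Metric.closedBall 0 C) ?_)
    (isCompact_closedBall _ _).measure_lt_top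
  rintro x ⟨hxK, hx⟩
  rw [mem_closedBall_zero_iff]
  refine norm_le_of_entries_le hx fun i k => ?_
  have := hent _ hxK (σ.symm i) (σ.symm k)
  rw [coneMap_of_pos hσ hx.1] at this
  simpa [fixColElt, blockSL] using this

instance : SecondCountableTopology SL(3, ℝ) :=
  isClosedEmbedding_entries.isInducing.secondCountableTopology

instance (j : Fin 3) : SecondCountableTopology (fixCol j) :=
  Topology.IsInducing.subtypeVal.secondCountableTopology

/-- The Haar measure is a multiple of the explicit measure. -/
lemma exists_haar_eq_smul (hσ : σ j = 0) :
    ∃ s : ℝ≥0∞, s ≠ ∞ ∧ (Measure.haar : Measure (fixCol j)) = s • coneMeasure hσ := by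
  have : (coneMeasure hσ).IsMulLeftInvariant := ⟨coneMeasure_map_mul_left hσ⟩
  have h := Measure.isMulLeftInvariant_eq_smul (coneMeasure hσ) (Measure.haar : Measure (fixCol j))
  set t := (coneMeasure hσ).haarScalarFactor (Measure.haar : Measure (fixCol j))
  have ht : t ≠ 0 := by
    intro ht
    apply coneMeasure_univ_ne_zero hσ
    rw [h, ht, zero_smul]
    rfl
  refine ⟨((t⁻¹ : NNReal) : ℝ≥0∞), ENNReal.coe_ne_top, ?_⟩
  have h2 : t⁻¹ • coneMeasure hσ = t⁻¹ • (t • (Measure.haar : Measure (fixCol j))) := by rw [← h]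
  rw [smul_smul, inv_mul_cancel₀ ht, one_smul] at h2
  exact h2.symm

/-! ### Integration over a set of representatives -/

/-- The measure induced on the homogeneous subspace is bounded by the image of the measure on any
measurable set that meets every coset. -/
lemma quotientMeasure_le_map {G : Type*} [Group G] [MeasurableSpace G] (Γ H : Subgroup G)
    [Countable Γ] (m : Measure H) (hm : ∀ γ : H, (γ : G) ∈ Γ → MeasurePreserving (· * γ) m m)
    {S : Set H} (hS : MeasurableSet S) (hcov : ∀ h : H, ∃ γ : H, (γ : G) ∈ Γ ∧ h * γ ∈ S) :
    quotientMeasure Γ H m ≤ (m.restrict S).map (orbitMap Γ H) := by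
  refine Measure.le_iff.2 fun A hA => ?_
  rw [quotientMeasure, Measure.ofMeasurable_apply A hA,
    Measure.map_apply (measurable_orbitMap Γ H) hA,
    Measure.restrict_apply (measurable_orbitMap Γ H hA)]
  refine iSup_le ?_
  rintro ⟨B, hB, hinj, hBA⟩
  let Γ' := {γ : H // (γ : G) ∈ Γ}
  have : Countable Γ' := Function.Injective.countable
    (f := fun γ : Γ' => (⟨(γ : H), γ.2⟩ : Γ))
    fun a b h => Subtype.ext (Subtype.ext (congrArg (fun x : Γ => (x : G)) h))
  -- `D γ` is the part of `B` that `γ` moves into `S`, and `D' γ` is its translate. The `D γ` cover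
  -- `B`; the `D' γ` have the same masses, lie in `S`, and are disjoint because the orbit map is
  -- injective on `B`.
  let D : Γ' → Set H := fun γ => (· * γ.1) ⁻¹' S ∩ B
  let D' : Γ' → Set H := fun γ => S ∩ (· * γ.1⁻¹) ⁻¹' B
  have hinv : ∀ γ : Γ', MeasurePreserving (· * γ.1⁻¹) m m := fun γ =>
    hm _ (by rw [Subgroup.coe_inv]; exact Γ.inv_mem γ.2)
  have hD' : ∀ γ, MeasurableSet (D' γ) := fun γ => hS.inter ((hinv γ).measurable hB)
  have hpre : ∀ γ : Γ', D γ = (· * γ.1) ⁻¹' D' γ := fun γ => by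
    ext x
    simp [D, D']
  have horb : ∀ (x : H) (γ : Γ'), orbitMap Γ H (x * γ.1) = orbitMap Γ H x := fun x γ => by
    refine QuotientGroup.eq.2 ?_
    simp [γ.2]
  have hU : B ⊆ ⋃ γ, D γ := fun x hx => by
    obtain ⟨γ, hγ, hx'⟩ := hcov x
    exact mem_iUnion.2 ⟨⟨γ, hγ⟩, hx', hx⟩
  have hdis : Pairwise (Function.onFun Disjoint D') := by
    intro γ δ hne
    refine disjoint_left.2 fun x hx hx' => hne ?_
    have h1 : orbitMap Γ H (x * γ.1⁻¹) = orbitMap Γ H (x * δ.1⁻¹) := by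
      rw [← horb (x * γ.1⁻¹) γ, ← horb (x * δ.1⁻¹) δ, inv_mul_cancel_right, inv_mul_cancel_right]
    exact Subtype.ext (inv_injective (mul_left_cancel (hinj hx.2 hx'.2 h1)))
  calc m B ≤ m (⋃ γ, D γ) := measure_mono hU
    _ ≤ ∑' γ, m (D γ) := measure_iUnion_le _
    _ = ∑' γ, m (D' γ) := tsum_congr fun γ => by
        rw [hpre γ, (hm γ.1 γ.2).measure_preimage (hD' γ).nullMeasurableSet]
    _ = m (⋃ γ, D' γ) := (measure_iUnion hdis hD').symm
    _ ≤ _ := by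
        refine measure_mono (iUnion_subset fun γ x hx => ⟨?_, hx.1⟩)
        have h := hBA hx.2
        rw [mem_preimage] at h ⊢
        rwa [← horb (x * γ.1⁻¹) γ, inv_mul_cancel_right] at h

instance : Countable Gam := by
  have : Countable SL(3, ℤ) :=
    Function.Injective.countable (f := fun g : SL(3, ℤ) => (fun i k => g.1 i k : Fin 3 → Fin 3 → ℤ))
      fun g h e => Subtype.ext e
  exact (MonoidHom.rangeRestrict_surjective
    (Matrix.SpecialLinearGroup.map (n := Fin 3) (Int.castRingHom ℝ))).countable

/-! ### Reduction of binary lattices -/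

/-- The inner product of the two columns. -/
def colInner (w : (ℝ × ℝ) × (ℝ × ℝ)) : ℝ := w.1.1 * w.2.1 + w.1.2 * w.2.2

/-- The square of the Euclidean length of the first column. -/
def colSq (w : (ℝ × ℝ) × (ℝ × ℝ)) : ℝ := w.1.1 ^ 2 + w.1.2 ^ 2

/-- A (homogeneous) condition that is satisfied by every reduced basis. -/
def IsReduced (w : (ℝ × ℝ) × (ℝ × ℝ)) : Prop :=
  colSq w ≤ 2 * det₂ w ∧ |colInner w| ≤ colSq w / 2

lemma norm_fst_sq_le (w : (ℝ × ℝ) × (ℝ × ℝ)) : ‖w.1‖ ^ 2 ≤ colSq w := by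
  rw [Prod.norm_def, colSq]
  rcases le_total ‖w.1.1‖ ‖w.1.2‖ with h | h
  · rw [max_eq_right h, Real.norm_eq_abs, sq_abs]
    nlinarith [sq_nonneg w.1.1]
  · rw [max_eq_left h, Real.norm_eq_abs, sq_abs]
    nlinarith [sq_nonneg w.1.2]

lemma isReduced_smul_iff {r : ℝ} (hr : 0 < r) (w : (ℝ × ℝ) × (ℝ × ℝ)) :
    IsReduced (r • w) ↔ IsReduced w := by
  have h1 : colSq (r • w) = r ^ 2 * colSq w := by
    simp only [colSq, Prod.smul_fst, Prod.smul_snd, smul_eq_mul]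
    ring
  have h2 : colInner (r • w) = r ^ 2 * colInner w := by
    simp only [colInner, Prod.smul_fst, Prod.smul_snd, smul_eq_mul]
    ring
  have hr2 : 0 < r ^ 2 := by positivity
  rw [IsReduced, IsReduced, h1, h2, det₂_smul, abs_mul, abs_of_pos hr2]
  constructor <;> rintro ⟨a, b⟩ <;> constructor <;> nlinarith

/-- Integer matrices with real entries. -/
def castW (g : (ℤ × ℤ) × (ℤ × ℤ)) : (ℝ × ℝ) × (ℝ × ℝ) := ((g.1.1, g.1.2), (g.2.1, g.2.2))

lemma det₂_castW (g : (ℤ × ℤ) × (ℤ × ℤ)) : det₂ (castW g) = (det₂ g : ℤ) := by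
  simp [det₂, castW]

/-- With the columns read as complex numbers, their quotient lies in the upper half plane and can be
moved into the standard fundamental domain of the modular group. -/
lemma exists_isReduced {w : (ℝ × ℝ) × (ℝ × ℝ)} (hw : det₂ w = 1) :
    ∃ g : (ℤ × ℤ) × (ℤ × ℤ), det₂ g = 1 ∧ IsReduced (mul₂ w (castW g)) := by
  obtain ⟨⟨a, c⟩, ⟨b, d⟩⟩ := w
  set ζ₁ : ℂ := ⟨a, c⟩
  set ζ₂ : ℂ := ⟨b, d⟩
  have hζ₁ : ζ₁ ≠ 0 := by
    intro h
    have h1 : a = 0 := congrArg Complex.re h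
    have h2 : c = 0 := congrArg Complex.im h
    simp [det₂, h1, h2] at hw
  have hN : 0 < Complex.normSq ζ₁ := Complex.normSq_pos.2 hζ₁
  have him : 0 < (ζ₂ / ζ₁).im := by
    have : (ζ₂ / ζ₁).im = 1 / Complex.normSq ζ₁ := by
      rw [Complex.div_im, ← hw]
      simp only [det₂, ζ₁, ζ₂]
      ring
    rw [this]
    positivity
  obtain ⟨g, hg1, hg2⟩ := ModularGroup.exists_smul_mem_fd ⟨ζ₂ / ζ₁, him⟩
  rw [← UpperHalfPlane.coe_re] at hg2
  rw [UpperHalfPlane.coe_specialLinearGroup_apply] at hg1 hg2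
  have hdet := g.det_coe
  rw [Matrix.det_fin_two] at hdet
  set p := g 0 0
  set q := g 0 1
  set r := g 1 0
  set s := g 1 1
  -- The Möbius action sends `ζ₂ / ζ₁` to `(p ζ₂ + q ζ₁) / (r ζ₂ + s ζ₁)`; denominator and numerator
  -- are the new first and second columns.
  refine ⟨((s, r), (q, p)), by simp only [det₂]; linarith, ?_⟩
  set η₁ : ℂ := ⟨a * s + b * r, c * s + d * r⟩ with hη₁
  set η₂ : ℂ := ⟨a * q + b * p, c * q + d * p⟩ with hη₂
  have e₁ : (r : ℂ) * ζ₂ + s * ζ₁ = η₁ := by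
    apply Complex.ext <;> simp [ζ₁, ζ₂, η₁] <;> ring
  have e₂ : (p : ℂ) * ζ₂ + q * ζ₁ = η₂ := by
    apply Complex.ext <;> simp [ζ₁, ζ₂, η₂] <;> ring
  have hdetw : det₂ (mul₂ ((a, c), (b, d)) (castW ((s, r), (q, p)))) = 1 := by
    rw [det₂_mul₂, hw, det₂_castW, one_mul]
    simp only [det₂]
    exact_mod_cast (by linarith : s * p - q * r = 1)
  have hη₁0 : η₁ ≠ 0 := by
    intro h
    have h1 : a * s + b * r = 0 := congrArg Complex.re h
    have h2 : c * s + d * r = 0 := congrArg Complex.im h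
    simp [det₂, mul₂, mulVec₂, castW, h1, h2] at hdetw
  have hquot : ((algebraMap ℤ ℝ p : ℂ) * (ζ₂ / ζ₁) + (algebraMap ℤ ℝ q : ℂ)) /
      ((algebraMap ℤ ℝ r : ℂ) * (ζ₂ / ζ₁) + (algebraMap ℤ ℝ s : ℂ)) = η₂ / η₁ := by
    rw [← e₁, ← e₂]
    simp only [algebraMap_int_eq, eq_intCast, Complex.ofReal_intCast]
    rw [← mul_div_mul_right _ _ hζ₁]
    congr 1 <;> field_simp
  have hN1 : 0 < Complex.normSq η₁ := Complex.normSq_pos.2 hη₁0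
  change 1 ≤ Complex.normSq (((algebraMap ℤ ℝ p : ℂ) * (ζ₂ / ζ₁) + (algebraMap ℤ ℝ q : ℂ)) /
      ((algebraMap ℤ ℝ r : ℂ) * (ζ₂ / ζ₁) + (algebraMap ℤ ℝ s : ℂ))) at hg1
  change |(((algebraMap ℤ ℝ p : ℂ) * (ζ₂ / ζ₁) + (algebraMap ℤ ℝ q : ℂ)) /
      ((algebraMap ℤ ℝ r : ℂ) * (ζ₂ / ζ₁) + (algebraMap ℤ ℝ s : ℂ))).re| ≤ 1 / 2 at hg2
  rw [hquot, Complex.normSq_div, le_div_iff₀ hN1, one_mul] at hg1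
  have hre : (η₂ / η₁).re =
      colInner (mul₂ ((a, c), (b, d)) (castW ((s, r), (q, p)))) / Complex.normSq η₁ := by
    rw [Complex.div_re]
    simp only [colInner, mul₂, mulVec₂, castW, hη₁, hη₂]
    ring
  rw [hquot, hre, abs_div, abs_of_pos hN1, div_le_iff₀ hN1] at hg2
  have hsq : colSq (mul₂ ((a, c), (b, d)) (castW ((s, r), (q, p)))) = Complex.normSq η₁ := by
    simp only [colSq, mul₂, mulVec₂, castW, Complex.normSq_mk, hη₁]
    ring
  -- Lagrange's identity. With `|η₁|² ≤ |η₂|²` and inner product at most `|η₁|² / 2` it gives `|η₁|⁴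
  -- ≤ 1 + |η₁|⁴ / 4`, hence `|η₁|² ≤ 2`.
  have hlag : Complex.normSq η₁ * Complex.normSq η₂ =
      det₂ (mul₂ ((a, c), (b, d)) (castW ((s, r), (q, p)))) ^ 2 +
      colInner (mul₂ ((a, c), (b, d)) (castW ((s, r), (q, p)))) ^ 2 := by
    simp only [colInner, det₂, mul₂, mulVec₂, castW, Complex.normSq_mk, hη₁, hη₂]
    ring
  rw [hdetw] at hlag
  refine ⟨?_, by rw [hsq]; linarith⟩
  rw [hsq, hdetw]
  have h3 := sq_le_sq' (neg_le_of_abs_le hg2) (le_of_abs_le hg2)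
  nlinarith

/-- A set of representatives of `fixCol j` modulo its integer points. -/
def siegelDomain (σ : Equiv.Perm (Fin 3)) (j : Fin 3) : Set (fixCol j) :=
  {h | IsReduced (blockW σ h.1) ∧ blockU σ h.1 ∈ Ioc (0 : ℝ) 1 ×ˢ Ioc (0 : ℝ) 1}

lemma measurableSet_isReduced : MeasurableSet {w : (ℝ × ℝ) × (ℝ × ℝ) | IsReduced w} := by
  have h1 : Continuous colSq := by unfold colSq; fun_prop
  have h2 : Continuous colInner := by unfold colInner; fun_prop
  exact ((isClosed_le h1 (continuous_det₂.const_smul (2 : ℝ))).inter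
    (isClosed_le h2.abs (h1.div_const 2))).measurableSet

lemma measurable_blockW (σ : Equiv.Perm (Fin 3)) : Measurable (blockW σ) := by
  have h := fun i k => (continuous_entry i k).measurable
  exact ((h _ _).prodMk (h _ _)).prodMk ((h _ _).prodMk (h _ _))

lemma measurable_blockU (σ : Equiv.Perm (Fin 3)) : Measurable (blockU σ) := by
  have h := fun i k => (continuous_entry i k).measurable
  exact (h _ _).prodMk (h _ _)

lemma measurableSet_siegelDomain : MeasurableSet (siegelDomain σ j) :=
  (((measurable_blockW σ).comp measurable_subtype_coe) measurableSet_isReduced).inter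
    (((measurable_blockU σ).comp measurable_subtype_coe)
      (measurableSet_Ioc.prod measurableSet_Ioc))

lemma fixColElt_castW_mem_Gam (hσ : σ j = 0) {g : (ℤ × ℤ) × (ℤ × ℤ)} (hg : det₂ g = 1)
    (n : ℤ × ℤ) (hg' : det₂ (castW g) = 1) :
    ((fixColElt hσ (castW g) ((n.1 : ℝ), (n.2 : ℝ)) hg' : fixCol j) : SL(3, ℝ)) ∈ Gam := by
  refine ⟨blockSL σ g n hg, Subtype.ext ?_⟩
  change ((blockMatrix g n).submatrix σ σ).map (Int.castRingHom ℝ) = _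
  rw [← Matrix.submatrix_map, map_blockMatrix]
  rfl

lemma exists_mul_mem_siegelDomain (hσ : σ j = 0) (h : fixCol j) :
    ∃ γ : fixCol j, (γ : SL(3, ℝ)) ∈ Gam ∧ h * γ ∈ siegelDomain σ j := by
  have hw := det₂_blockW hσ h
  obtain ⟨g, hg, hred⟩ := exists_isReduced hw
  have hg' : det₂ (castW g) = 1 := by rw [det₂_castW, hg, Int.cast_one]
  set v := vecMul₂ (blockU σ h.1) (castW g)
  refine ⟨fixColElt hσ (castW g) (((1 - ⌈v.1⌉ : ℤ) : ℝ), ((1 - ⌈v.2⌉ : ℤ) : ℝ)) hg',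
    -- Adding `1 - ⌈x⌉` puts `x` into `(0, 1]`, the interval that parametrizes the circle below.
    fixColElt_castW_mem_Gam hσ hg (1 - ⌈v.1⌉, 1 - ⌈v.2⌉) hg', ?_⟩
  conv => enter [2, 1]; rw [eq_fixColElt hσ h]
  rw [fixColElt_mul]
  have hshift : ∀ x : ℝ, ((1 - ⌈x⌉ : ℤ) : ℝ) + x ∈ Ioc (0 : ℝ) 1 := fun x => by
    have h1 := Int.le_ceil x
    have h2 := Int.ceil_lt_add_one x
    push_cast
    constructor <;> linarith
  refine ⟨?_, ?_⟩
  · rw [fixColElt, blockW_blockSL]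
    exact hred
  · rw [fixColElt, blockU_blockSL]
    exact ⟨hshift v.1, hshift v.2⟩

/-! ### Integrals over the reduced part of the cone -/

/-- Reduced matrices of determinant in `(0, 1]`. -/
def reducedCone : Set ((ℝ × ℝ) × (ℝ × ℝ)) := {w | (0 < det₂ w ∧ det₂ w ≤ 1) ∧ IsReduced w}

lemma measurableSet_reducedCone : MeasurableSet reducedCone :=
  ((measurableSet_lt measurable_const continuous_det₂.measurable).inter
    (measurableSet_le continuous_det₂.measurable measurable_const)).inter measurableSet_isReduced

lemma norm_fst_lt_two {w : (ℝ × ℝ) × (ℝ × ℝ)} (hw : w ∈ reducedCone) : ‖w.1‖ < 2 := by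
  have h1 := norm_fst_sq_le w
  have h2 := hw.2.1
  have h3 := hw.1.2
  nlinarith [norm_nonneg w.1]

/-- The map `y ↦ (det, inner product)` has determinant `-|x|²` and sends the slice into a rectangle
of area `|x|²`, so the bound does not depend on `x`. -/
lemma volume_reducedCone_slice_le {x : ℝ × ℝ} (hx : x ≠ 0) :
    volume {y | (x, y) ∈ reducedCone} ≤ 1 := by
  set f := Matrix.toLin (Module.Basis.finTwoProd ℝ) (Module.Basis.finTwoProd ℝ)
    !![-x.2, x.1; x.1, x.2]
  set N := x.1 ^ 2 + x.2 ^ 2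
  have hN : 0 < N := by
    by_contra! h
    have h1 : x.1 ^ 2 = 0 := by nlinarith [sq_nonneg x.1, sq_nonneg x.2]
    have h2 : x.2 ^ 2 = 0 := by nlinarith [sq_nonneg x.1, sq_nonneg x.2]
    exact hx (Prod.ext (pow_eq_zero_iff two_ne_zero |>.1 h1) (pow_eq_zero_iff two_ne_zero |>.1 h2))
  have hdet : LinearMap.det f = -N := by
    rw [LinearMap.det_toLin, Matrix.det_fin_two_of]
    simp only [N]
    ring
  have hf : ∀ y, f y = (-x.2 * y.1 + x.1 * y.2, x.1 * y.1 + x.2 * y.2) :=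
    Matrix.toLin_finTwoProd_apply _ _ _ _
  have hsub : {y | (x, y) ∈ reducedCone} ⊆ f ⁻¹' (Ioc 0 1 ×ˢ Icc (-(N / 2)) (N / 2)) := by
    rintro y ⟨⟨h1, h2⟩, -, h3⟩
    rw [mem_preimage, hf]
    simp only [det₂, colInner, colSq] at h1 h2 h3
    exact ⟨⟨by simp only; linarith, by simp only; linarith⟩, abs_le.1 h3⟩
  refine (measure_mono hsub).trans ?_
  rw [Measure.addHaar_preimage_linearMap _ (by rw [hdet]; exact (neg_lt_zero.2 hN).ne), hdet]
  change _ * ((volume : Measure ℝ).prod (volume : Measure ℝ)) _ ≤ 1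
  rw [Measure.prod_prod, Real.volume_Ioc, Real.volume_Icc, ← ENNReal.ofReal_mul (by norm_num),
    ← ENNReal.ofReal_mul (by positivity)]
  rw [ENNReal.ofReal_le_one, inv_neg, abs_neg, abs_of_pos (inv_pos.2 hN)]
  field_simp
  norm_num

/-- In polar coordinates the integrand becomes `y ^ (1 - p)`, integrable at zero because `p < 2`. -/
lemma lintegral_ball_norm_rpow_ne_top {p : ℝ} (hp : p < 2) :
    ∫⁻ x in Metric.ball (0 : ℝ × ℝ) 2, ENNReal.ofReal (‖x‖ ^ (-p)) ≠ ∞ := by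
  have hint : IntegrableOn (fun x : ℝ × ℝ => ‖x‖ ^ (-p)) (Metric.ball 0 2) := by
    rw [integrableOn_fun_norm_addHaar volume (f := fun y : ℝ => y ^ (-p))]
    have h1 : IntegrableOn (fun y : ℝ => y ^ (1 - p)) (Ioo 0 2) :=
      (intervalIntegral.integrableOn_Ioo_rpow_iff (by norm_num)).2 (by linarith)
    refine h1.congr_fun (fun y hy => ?_) measurableSet_Ioo
    simp only [Module.finrank_prod, Module.finrank_self, smul_eq_mul]
    rw [show 1 + 1 - 1 = 1 from rfl, pow_one, sub_eq_add_neg, Real.rpow_add hy.1, Real.rpow_one]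
  exact hint.lintegral_lt_top.ne

/-- This controls the cusp. Integration over the second column contributes a factor at most one, and
reduction confines the first column to the ball of radius two. -/
lemma lintegral_reducedCone_ne_top {p : ℝ} (hp : p < 2) :
    ∫⁻ w in reducedCone, ENNReal.ofReal (‖w.1‖ ^ (-p)) ≠ ∞ := by
  refine ne_top_of_le_ne_top (lintegral_ball_norm_rpow_ne_top hp) ?_
  have hmeas : Measurable fun x : ℝ × ℝ => ENNReal.ofReal (‖x‖ ^ (-p)) := by fun_prop
  rw [← lintegral_indicator measurableSet_reducedCone,
    ← lintegral_indicator Metric.isOpen_ball.measurableSet]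
  change ∫⁻ w, _ ∂((volume : Measure (ℝ × ℝ)).prod (volume : Measure (ℝ × ℝ))) ≤ _
  have hmeas' : Measurable fun w : (ℝ × ℝ) × (ℝ × ℝ) => ENNReal.ofReal (‖w.1‖ ^ (-p)) :=
    hmeas.comp measurable_fst
  rw [lintegral_prod _ (hmeas'.indicator measurableSet_reducedCone).aemeasurable]
  refine lintegral_mono_ae ?_
  have h0 : ∀ᵐ x : ℝ × ℝ, x ≠ 0 := by simp [ae_iff]
  filter_upwards [h0] with x hx
  by_cases hb : x ∈ Metric.ball (0 : ℝ × ℝ) 2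
  · rw [indicator_of_mem hb]
    have hsl : MeasurableSet {y | (x, y) ∈ reducedCone} :=
      measurable_prodMk_left measurableSet_reducedCone
    calc ∫⁻ y, reducedCone.indicator (fun w => ENNReal.ofReal (‖w.1‖ ^ (-p))) (x, y)
        = ∫⁻ y, {y | (x, y) ∈ reducedCone}.indicator
            (fun _ => ENNReal.ofReal (‖x‖ ^ (-p))) y := rfl
      _ = ENNReal.ofReal (‖x‖ ^ (-p)) * volume {y | (x, y) ∈ reducedCone} := by
          rw [lintegral_indicator_const hsl]
      _ ≤ ENNReal.ofReal (‖x‖ ^ (-p)) * 1 := by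
          gcongr
          exact volume_reducedCone_slice_le hx
      _ = _ := mul_one _
  · rw [indicator_of_notMem hb]
    refine le_of_eq ((lintegral_congr fun y => indicator_of_notMem (fun h => hb ?_) _).trans
      lintegral_zero)
    rw [mem_ball_zero_iff]
    exact norm_fst_lt_two h

/-! ### The Siegel transform as a sum over integer vectors -/

/-- The image of an integer vector under a matrix. -/
def latPoint (g : SL(3, ℝ)) (z : Fin 3 → ℤ) : Fin 3 → ℝ := g.1.mulVec fun i => (z i : ℝ)

lemma latPoint_injective (g : SL(3, ℝ)) : Function.Injective (latPoint g) := by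
  intro y z h
  have hu : IsUnit g.1 := (Matrix.isUnit_iff_isUnit_det _).2 (by rw [g.2]; exact isUnit_one)
  have h1 := Matrix.mulVec_injective_of_isUnit hu h
  funext i
  exact_mod_cast congrFun h1 i

lemma latPoint_zero (g : SL(3, ℝ)) : latPoint g 0 = 0 := by
  change g.1.mulVec (fun i => ((0 : ℤ) : ℝ)) = 0
  simp only [Int.cast_zero]
  exact Matrix.mulVec_zero _

lemma latticeOf_mk (g : SL(3, ℝ)) : latticeOf (g : X) = range (latPoint g) := by
  ext w
  constructor
  · rintro ⟨g', hg', v, rfl⟩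
    obtain ⟨γ, hγ⟩ := QuotientGroup.eq.1 hg'.symm
    refine ⟨γ.1.mulVec v, ?_⟩
    have hcast : (fun i => ((γ.1.mulVec v i : ℤ) : ℝ)) =
        ((γ.1.map (Int.castRingHom ℝ)).mulVec fun i => (v i : ℝ)) := by
      funext i
      simp [Matrix.mulVec, dotProduct]
    have hmul : g.1 * γ.1.map (Int.castRingHom ℝ) = g'.1 := by
      have : g * Matrix.SpecialLinearGroup.map (n := Fin 3) (Int.castRingHom ℝ) γ = g' := by
        rw [hγ, mul_inv_cancel_left]
      exact congrArg Subtype.val this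
    rw [latPoint, hcast, Matrix.mulVec_mulVec, hmul]
  · rintro ⟨v, rfl⟩
    exact ⟨g, rfl, v, rfl⟩

/-- Nonzero integer vectors are in bijection with nonzero lattice points. -/
noncomputable def latPointEquiv (g : SL(3, ℝ)) :
    {z : Fin 3 → ℤ // z ≠ 0} ≃ ↥(latticeOf (g : X) \ {0}) :=
  Equiv.ofBijective (fun z => ⟨latPoint g z, by rw [latticeOf_mk]; exact ⟨z, rfl⟩, fun h =>
      z.2 (latPoint_injective g (h.trans (latPoint_zero g).symm))⟩)
    ⟨fun y z h => Subtype.ext (latPoint_injective g (congrArg Subtype.val h)), by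
      rintro ⟨w, hw, hw0⟩
      rw [latticeOf_mk] at hw
      obtain ⟨z, rfl⟩ := hw
      exact ⟨⟨z, fun h => hw0 (by rw [h, latPoint_zero]; rfl)⟩, rfl⟩⟩

/-- If the series diverges, both sides take the default value zero. -/
lemma siegel_mk {f : (Fin 3 → ℝ) → ℝ} (hf : ∀ x, 0 ≤ f x) (g : SL(3, ℝ)) :
    siegel f (g : X) =
      (∑' z : {z : Fin 3 → ℤ // z ≠ 0}, ENNReal.ofReal (f (latPoint g z))).toReal := by
  rw [siegel, ENNReal.tsum_toReal_eq fun z => ENNReal.ofReal_ne_top,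
    ← (latPointEquiv g).tsum_eq]
  exact tsum_congr fun z => (ENNReal.toReal_ofReal (hf _)).symm

lemma measurable_latPoint (z : Fin 3 → ℤ) : Measurable fun g => latPoint g z := by
  refine measurable_pi_lambda _ fun i => ?_
  simp only [latPoint, Matrix.mulVec, dotProduct]
  exact Finset.measurable_fun_sum _ fun k _ => (continuous_entry i k).measurable.mul_const _

lemma siegel_nonneg {f : (Fin 3 → ℝ) → ℝ} (hf : ∀ x, 0 ≤ f x) (x : X) : 0 ≤ siegel f x :=
  tsum_nonneg fun _ => hf _

lemma measurable_siegel {f : (Fin 3 → ℝ) → ℝ} (hfm : Measurable f) (hf : ∀ x, 0 ≤ f x)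
    (b : SL(3, ℝ)) : Measurable fun y : X => siegel f (b • y) := by
  have h : Measurable fun g : SL(3, ℝ) => siegel f (b • (g : X)) := by
    have heq : ∀ g : SL(3, ℝ), siegel f (b • (g : X)) =
        (∑' z : {z : Fin 3 → ℤ // z ≠ 0}, ENNReal.ofReal (f (latPoint (b * g) z))).toReal :=
      fun g => siegel_mk hf (b * g)
    simp_rw [heq]
    refine (Measurable.tsum fun z => ?_).ennreal_toReal
    exact (hfm.comp ((measurable_latPoint z.1).comp (measurable_const_mul b))).ennreal_ofReal
  exact fun s hs => h hs

lemma ofReal_siegel_rpow_le {f : (Fin 3 → ℝ) → ℝ} (hf : ∀ x, 0 ≤ f x) {p : ℝ} (hp : 0 ≤ p)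
    (g : SL(3, ℝ)) : ENNReal.ofReal (siegel f (g : X) ^ p) ≤
      (∑' z : {z : Fin 3 → ℤ // z ≠ 0}, ENNReal.ofReal (f (latPoint g z))) ^ p := by
  rw [← ENNReal.ofReal_rpow_of_nonneg (siegel_nonneg hf _) hp, siegel_mk hf]
  exact ENNReal.rpow_le_rpow ENNReal.ofReal_toReal_le hp

/-! ### Comparison with near returns on the torus -/

/-- Integer vectors in block coordinates. -/
def blockVecEquiv (σ : Equiv.Perm (Fin 3)) : (ℤ × ℤ) × ℤ ≃ (Fin 3 → ℤ) where
  toFun v := fun i => ![v.2, v.1.1, v.1.2] (σ i)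
  invFun z := ((z (σ.symm 1), z (σ.symm 2)), z (σ.symm 0))
  left_inv v := by simp
  right_inv z := by
    funext i
    obtain ⟨k, rfl⟩ := σ.symm.surjective i
    fin_cases k <;> simp

lemma latPoint_fixColElt (hσ : σ j = 0) {w : (ℝ × ℝ) × (ℝ × ℝ)} (u : ℝ × ℝ) (hw : det₂ w = 1)
    (v : ℤ × ℤ) (k : ℤ) (i : Fin 3) :
    latPoint (fixColElt hσ w u hw : fixCol j) (blockVecEquiv σ (v, k)) (σ.symm i) =
      ![(k : ℝ) + (u.1 * v.1 + u.2 * v.2), (latVec w v).1, (latVec w v).2] i := by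
  have h1 : latPoint (fixColElt hσ w u hw : fixCol j) (blockVecEquiv σ (v, k)) =
      ((blockMatrix w u).submatrix σ σ).mulVec
        ((fun m => ((![k, v.1, v.2] m : ℤ) : ℝ)) ∘ σ) := rfl
  rw [h1, Matrix.submatrix_mulVec_equiv]
  simp only [Function.comp_apply, Equiv.apply_symm_apply]
  fin_cases i <;>
    simp [blockMatrix, Matrix.mulVec, dotProduct, Fin.sum_univ_three, latVec] <;> ring

/-- The point of the torus with coordinates `u`. -/
noncomputable def toTorus (u : ℝ × ℝ) : UnitAddCircle × UnitAddCircle :=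
  ((u.1 : UnitAddCircle), (u.2 : UnitAddCircle))

lemma torusHom_toTorus (v : ℤ × ℤ) (u : ℝ × ℝ) :
    torusHom v (toTorus u) = ((u.1 * v.1 + u.2 * v.2 : ℝ) : UnitAddCircle) := by
  rw [torusHom_apply, toTorus, ← AddCircle.coe_zsmul, ← AddCircle.coe_zsmul, ← AddCircle.coe_add,
    zsmul_eq_mul, zsmul_eq_mul, mul_comm, mul_comm (v.2 : ℝ)]

lemma toTorus_mem_nearReturn {ε : ℝ} {v : ℤ × ℤ} {u : ℝ × ℝ} {k : ℤ}
    (h : |(k : ℝ) + (u.1 * v.1 + u.2 * v.2)| ≤ ε) : toTorus u ∈ nearReturn ε v := by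
  rw [nearReturn, mem_preimage, mem_closedBall_zero_iff, torusHom_toTorus, UnitAddCircle.norm_eq]
  refine (round_le _ (-k)).trans ?_
  push_cast
  rw [sub_neg_eq_add, add_comm]
  exact h

lemma measurePreserving_toTorus :
    MeasurePreserving toTorus (volume.restrict (Ioc (0 : ℝ) 1 ×ˢ Ioc (0 : ℝ) 1)) volume := by
  have h := UnitAddCircle.measurePreserving_mk 0
  rw [zero_add] at h
  have h2 := h.prod h
  rw [Measure.prod_restrict] at h2
  exact h2

/-- Over each `v` at most `2 ε + 1 ≤ 3` integers `k` contribute, and any one of them makes `v` a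
near return. -/
lemma tsum_le_returnCount (hσ : σ j = 0) {w : (ℝ × ℝ) × (ℝ × ℝ)} (u : ℝ × ℝ) (hw : det₂ w = 1)
    {R ε : ℝ} (hε0 : 0 ≤ ε) (hε : ε < 1) {f : (Fin 3 → ℝ) → ℝ} (hf : ∀ x, f x ≤ 1)
    (b : SL(3, ℝ))
    (hb : ∀ z : Fin 3 → ℤ, ∀ h : SL(3, ℝ), f (latPoint (b * h) z) ≠ 0 →
      |latPoint h z (σ.symm 0)| ≤ ε ∧ |latPoint h z (σ.symm 1)| ≤ R ∧
        |latPoint h z (σ.symm 2)| ≤ R) :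
    ∑' z : {z : Fin 3 → ℤ // z ≠ 0},
        ENNReal.ofReal (f (latPoint (b * (fixColElt hσ w u hw : fixCol j)) z)) ≤
      3 * returnCount ε (squarePoints w R) (toTorus u) := by
  classical
  set h : SL(3, ℝ) := ((fixColElt hσ w u hw : fixCol j) : SL(3, ℝ))
  set ψ : (Fin 3 → ℤ) → ℝ≥0∞ := fun z => ENNReal.ofReal (f (latPoint (b * h) z))
  set ψ' : (Fin 3 → ℤ) → ℝ≥0∞ := {z | z ≠ 0}.indicator ψ
  have hrow : ∀ v : ℤ × ℤ, ∑' k : ℤ, ψ' (blockVecEquiv σ (v, k)) ≤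
      3 * (squarePoints w R).indicator
        (fun v => (nearReturn ε v).indicator (1 : UnitAddCircle × UnitAddCircle → ℝ≥0∞)
          (toTorus u)) v := by
    intro v
    have hsupp : ∀ k : ℤ, ψ' (blockVecEquiv σ (v, k)) ≠ 0 →
        v ∈ squarePoints w R ∧ |(k : ℝ) + (u.1 * v.1 + u.2 * v.2)| ≤ ε := by
      intro k hk
      have hz : blockVecEquiv σ (v, k) ≠ 0 := mem_of_indicator_ne_zero hk
      have hne : f (latPoint (b * h) (blockVecEquiv σ (v, k))) ≠ 0 := by
        intro h0
        apply hk
        simp only [ψ', ψ, indicator, h0, ENNReal.ofReal_zero, ite_self]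
      obtain ⟨h0, h1, h2⟩ := hb _ h hne
      rw [latPoint_fixColElt] at h0 h1 h2
      simp only [Matrix.cons_val] at h0 h1 h2
      refine ⟨⟨fun hv => hz ?_, ?_⟩, h0⟩
      -- For `v = 0` the condition reads `|k| ≤ ε < 1`, so the vector would be zero. Without `ε < 1`
      -- the fixed basis vector would contribute for every lattice.
      · subst hv
        have hk0 : |(k : ℝ)| < 1 := by
          refine lt_of_le_of_lt ?_ hε
          simpa using h0
        have : k = 0 := Int.abs_lt_one_iff.1 (by exact_mod_cast hk0)
        subst this
        funext i
        obtain ⟨m, rfl⟩ := σ.symm.surjective i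
        fin_cases m <;> simp [blockVecEquiv]
      · exact max_le h1 h2
    by_cases hex : ∃ k : ℤ, ψ' (blockVecEquiv σ (v, k)) ≠ 0
    · obtain ⟨k₀, hk₀⟩ := hex
      obtain ⟨hv, hk₀'⟩ := hsupp k₀ hk₀
      rw [indicator_of_mem hv, indicator_of_mem (toTorus_mem_nearReturn hk₀')]
      set Ks : Set ℤ := {k : ℤ | |(k : ℝ) + (u.1 * v.1 + u.2 * v.2)| ≤ ε}
      calc ∑' k : ℤ, ψ' (blockVecEquiv σ (v, k)) ≤ ∑' k : ℤ, Ks.indicator (fun _ => 1) k := by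
            refine ENNReal.tsum_le_tsum fun k => ?_
            by_cases hk : ψ' (blockVecEquiv σ (v, k)) = 0
            · rw [hk]
              exact zero_le
            · have hkm : k ∈ Ks := (hsupp k hk).2
              rw [indicator_of_mem hkm]
              refine (indicator_le_self _ _ _).trans ?_
              exact ENNReal.ofReal_le_one.2 (hf _)
        _ = Ks.encard := by rw [← tsum_subtype Ks fun _ => (1 : ℝ≥0∞), ENNReal.tsum_set_one]
        _ ≤ ENNReal.ofReal (2 * ε + 1) := encard_int_abs_add_le _ hε0
        _ ≤ ENNReal.ofReal 3 := ENNReal.ofReal_le_ofReal (by linarith)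
        _ = _ := by simp
    · push Not at hex
      simp [hex]
  calc ∑' z : {z : Fin 3 → ℤ // z ≠ 0}, ψ z = ∑' z, ψ' z := tsum_subtype {z | z ≠ 0} ψ
    _ = ∑' x, ψ' (blockVecEquiv σ x) := ((blockVecEquiv σ).tsum_eq ψ').symm
    _ = ∑' v, ∑' k, ψ' (blockVecEquiv σ (v, k)) := ENNReal.tsum_prod'
    _ ≤ _ := ENNReal.tsum_le_tsum hrow
    _ = _ := by
      rw [ENNReal.tsum_mul_left, returnCount, ← tsum_subtype]

/-! ### The moment bound -/

lemma coneMap_mem_siegelDomain_iff (hσ : σ j = 0) {x : ((ℝ × ℝ) × (ℝ × ℝ)) × (ℝ × ℝ)}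
    (hx : 0 < det₂ x.1) : coneMap hσ x ∈ siegelDomain σ j ↔
      IsReduced x.1 ∧ x.2 ∈ Ioc (0 : ℝ) 1 ×ˢ Ioc (0 : ℝ) 1 := by
  rw [coneMap_of_pos hσ hx, siegelDomain, mem_ofPred_eq, fixColElt, blockW_blockSL, blockU_blockSL,
    unimod, isReduced_smul_iff (inv_pos.2 (Real.sqrt_pos.2 hx))]

lemma coneDomain_inter_preimage (hσ : σ j = 0) :
    coneMap hσ ⁻¹' siegelDomain σ j ∩ coneDomain =
      reducedCone ×ˢ (Ioc (0 : ℝ) 1 ×ˢ Ioc (0 : ℝ) 1) := by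
  ext x
  constructor
  · rintro ⟨h1, h2⟩
    obtain ⟨h3, h4⟩ := (coneMap_mem_siegelDomain_iff hσ h2.1).1 h1
    exact ⟨⟨h2, h3⟩, h4⟩
  · rintro ⟨⟨h2, h3⟩, h4⟩
    exact ⟨(coneMap_mem_siegelDomain_iff hσ h2.1).2 ⟨h3, h4⟩, h2⟩

lemma setLIntegral_siegelDomain_coneMeasure (hσ : σ j = 0) {F : fixCol j → ℝ≥0∞}
    (hF : Measurable F) :
    ∫⁻ h in siegelDomain σ j, F h ∂coneMeasure hσ =
      ∫⁻ w in reducedCone, ∫⁻ u in Ioc (0 : ℝ) 1 ×ˢ Ioc (0 : ℝ) 1, F (coneMap hσ (w, u)) := by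
  rw [coneMeasure, setLIntegral_map measurableSet_siegelDomain hF (measurable_coneMap hσ),
    Measure.restrict_restrict (measurable_coneMap hσ measurableSet_siegelDomain),
    coneDomain_inter_preimage hσ]
  change ∫⁻ x, F (coneMap hσ x) ∂((volume.prod volume).restrict _) = _
  have hm : Measurable fun x => F (coneMap hσ x) := hF.comp (measurable_coneMap hσ)
  rw [← Measure.prod_restrict, lintegral_prod _ hm.aemeasurable]

/-- The translate of `siegelDomain` by `k` also meets every coset, and left invariance moves `k`
into the integrand. The freedom in `k` is what permits renormalizing the rectangle to a square. -/
lemma lintegral_quotientMeasure_le (hσ : σ j = 0) (k : fixCol j) {F : X → ℝ≥0∞}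
    (hF : Measurable F) :
    ∫⁻ y, F y ∂quotientMeasure Gam (fixCol j) Measure.haar ≤
      ∫⁻ h in siegelDomain σ j, F (orbitMap Gam (fixCol j) (k * h)) ∂Measure.haar := by
  obtain ⟨s, -, hs⟩ := exists_haar_eq_smul hσ
  have hright : ∀ γ : fixCol j, MeasurePreserving (· * γ) (Measure.haar : Measure (fixCol j))
      Measure.haar := fun γ => by
    refine ⟨measurable_mul_const γ, ?_⟩
    rw [hs, Measure.map_smul, coneMeasure_map_mul_right]
  have hSm : MeasurableSet ((k⁻¹ * ·) ⁻¹' siegelDomain σ j) :=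
    measurable_const_mul k⁻¹ measurableSet_siegelDomain
  have hcov : ∀ h : fixCol j, ∃ γ : fixCol j, (γ : SL(3, ℝ)) ∈ Gam ∧
      h * γ ∈ (k⁻¹ * ·) ⁻¹' siegelDomain σ j := fun h => by
    obtain ⟨γ, hγ, hm⟩ := exists_mul_mem_siegelDomain hσ (k⁻¹ * h)
    exact ⟨γ, hγ, by rwa [mem_preimage, ← mul_assoc]⟩
  have hFo : Measurable fun h => F (orbitMap Gam (fixCol j) h) :=
    hF.comp (measurable_orbitMap Gam (fixCol j))
  have hleft := measurePreserving_mul_left (Measure.haar : Measure (fixCol j)) k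
  calc ∫⁻ y, F y ∂quotientMeasure Gam (fixCol j) Measure.haar
      ≤ ∫⁻ y, F y ∂((Measure.haar : Measure (fixCol j)).restrict
          ((k⁻¹ * ·) ⁻¹' siegelDomain σ j)).map (orbitMap Gam (fixCol j)) :=
        lintegral_mono' (quotientMeasure_le_map Gam (fixCol j) _ (fun γ _ => hright γ) hSm hcov)
          le_rfl
    _ = ∫⁻ h in (k⁻¹ * ·) ⁻¹' siegelDomain σ j, F (orbitMap Gam (fixCol j) h) ∂Measure.haar :=
        lintegral_map hF (measurable_orbitMap Gam (fixCol j))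
    _ = ∫⁻ h in (k * ·) ⁻¹' ((k⁻¹ * ·) ⁻¹' siegelDomain σ j),
          F (orbitMap Gam (fixCol j) (k * h)) ∂Measure.haar :=
        (hleft.setLIntegral_comp_preimage hSm hFo).symm
    _ = _ := by
        congr 2
        ext h
        simp

lemma lintegral_toTorus_returnCount_le {p : ℝ} (hp1 : 1 ≤ p) {K : ℝ≥0∞}
    (hK : ∀ w : (ℝ × ℝ) × (ℝ × ℝ), det₂ w = 1 → ‖w.1‖ ^ 2 ≤ 2 →
      ∀ R ε : ℝ, 0 ≤ R → 0 ≤ ε →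
      ∫⁻ t, returnCount ε (squarePoints w R) t ^ p ≤
        K * (ENNReal.ofReal (ε * (R / ‖w.1‖) ^ p) +
          ENNReal.ofReal (ε * R ^ 2 + (ε * R ^ 2) ^ 2)))
    {w : (ℝ × ℝ) × (ℝ × ℝ)} (hw : w ∈ reducedCone) {R ε : ℝ} (hR : 0 ≤ R) (hε : 0 ≤ ε) :
    ∫⁻ u in Ioc (0 : ℝ) 1 ×ˢ Ioc (0 : ℝ) 1,
        (3 * returnCount ε (squarePoints (unimod w) R) (toTorus u)) ^ p ≤
      3 ^ p * K * (ENNReal.ofReal (ε * R ^ p) * ENNReal.ofReal (‖w.1‖ ^ (-p)) +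
        ENNReal.ofReal (ε * R ^ 2 + (ε * R ^ 2) ^ 2)) := by
  have hp0 : 0 ≤ p := by linarith
  have hs : 0 < √(det₂ w) := Real.sqrt_pos.2 hw.1.1
  have hdet := det₂_unimod hw.1.1
  have hshort : ‖(unimod w).1‖ ^ 2 ≤ 2 := by
    have h1 := ((isReduced_smul_iff (inv_pos.2 hs) w).2 hw.2).1
    change colSq (unimod w) ≤ 2 * det₂ (unimod w) at h1
    rw [hdet] at h1
    linarith [norm_fst_sq_le (unimod w)]
  have hwpos : 0 < ‖w.1‖ := norm_fst_pos hw.1.1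
  -- Replaces the normalized matrix by `w` itself, whose negative power is integrable over the
  -- reduced cone.
  have hnorm : ‖w.1‖ ≤ ‖(unimod w).1‖ := by
    rw [unimod, Prod.smul_fst, norm_smul, norm_inv, Real.norm_of_nonneg hs.le,
      ← div_eq_inv_mul, le_div_iff₀ hs]
    exact mul_le_of_le_one_right hwpos.le (Real.sqrt_le_one.2 hw.1.2)
  have hmeas : Measurable fun t => (3 * returnCount ε (squarePoints (unimod w) R) t) ^ p :=
    ((measurable_returnCount ε _).const_mul 3).pow_const p
  rw [measurePreserving_toTorus.lintegral_comp hmeas]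
  simp_rw [ENNReal.mul_rpow_of_nonneg _ _ hp0]
  rw [lintegral_const_mul _ ((measurable_returnCount ε _).pow_const p), mul_assoc]
  refine mul_le_mul_right ((hK _ hdet hshort R ε hR hε).trans ?_) _
  gcongr
  rw [← ENNReal.ofReal_mul (by positivity), mul_assoc, Real.rpow_neg hwpos.le, ← div_eq_mul_inv,
    ← Real.div_rpow hR hwpos.le]
  gcongr

/-- The moment bound in normalized form. -/
lemma exists_lintegral_siegel_le (hσ : σ j = 0) {p : ℝ} (hp1 : 1 ≤ p) (hp2 : p < 2) :
    ∃ C : ℝ≥0∞, C ≠ ∞ ∧ ∀ (R ε : ℝ), 0 ≤ R → 0 ≤ ε → ε < 1 →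
      ∀ f : (Fin 3 → ℝ) → ℝ, Measurable f → (∀ x, 0 ≤ f x ∧ f x ≤ 1) →
      ∀ (b : SL(3, ℝ)) (k : fixCol j),
      (∀ z : Fin 3 → ℤ, ∀ h : SL(3, ℝ), f (latPoint (b * k * h) z) ≠ 0 →
        |latPoint h z (σ.symm 0)| ≤ ε ∧ |latPoint h z (σ.symm 1)| ≤ R ∧
          |latPoint h z (σ.symm 2)| ≤ R) →
      ∫⁻ y, ENNReal.ofReal (siegel f (b • y) ^ p)
          ∂quotientMeasure Gam (fixCol j) Measure.haar ≤
        C * (ENNReal.ofReal (ε * R ^ p) + ENNReal.ofReal (ε * R ^ 2 + (ε * R ^ 2) ^ 2)) := by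
  have hp0 : 0 ≤ p := by linarith
  obtain ⟨K, hKtop, hK⟩ := exists_lintegral_returnCount_le hp1 hp2
  obtain ⟨s, hsfin, hs⟩ := exists_haar_eq_smul hσ
  set I₀ := volume reducedCone
  have hI₀ : I₀ ≠ ∞ := by
    have h := lintegral_reducedCone_ne_top (p := 0) two_pos
    simpa using h
  set Iₚ := ∫⁻ w in reducedCone, ENNReal.ofReal (‖w.1‖ ^ (-p))
  have hIₚ : Iₚ ≠ ∞ := lintegral_reducedCone_ne_top hp2
  refine ⟨s * (3 ^ p * K * (Iₚ + I₀)), ENNReal.mul_ne_top hsfin (ENNReal.mul_ne_top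
    (ENNReal.mul_ne_top (ENNReal.rpow_ne_top_of_nonneg hp0 (by simp)) hKtop)
    (ENNReal.add_ne_top.2 ⟨hIₚ, hI₀⟩)), ?_⟩
  intro R ε hR hε hε1 f hfm hf b k hb
  have hF : Measurable fun y : X => ENNReal.ofReal (siegel f (b • y) ^ p) :=
    ((measurable_siegel hfm (fun x => (hf x).1) b).pow_const p).ennreal_ofReal
  refine (lintegral_quotientMeasure_le hσ k hF).trans ?_
  have hFk : Measurable fun h : fixCol j =>
      ENNReal.ofReal (siegel f (b • orbitMap Gam (fixCol j) (k * h)) ^ p) :=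
    hF.comp ((measurable_orbitMap Gam (fixCol j)).comp (measurable_const_mul k))
  have hpt : ∀ w ∈ reducedCone, ∀ u : ℝ × ℝ,
      ENNReal.ofReal (siegel f (b • orbitMap Gam (fixCol j) (k * coneMap hσ (w, u))) ^ p) ≤
        (3 * returnCount ε (squarePoints (unimod w) R) (toTorus u)) ^ p := by
    intro w hw u
    rw [coneMap_of_pos hσ (x := (w, u)) hw.1.1]
    refine (ofReal_siegel_rpow_le (fun x => (hf x).1) hp0
      (b * (k * fixColElt hσ (unimod w) u (det₂_unimod hw.1.1) : fixCol j))).trans ?_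
    refine ENNReal.rpow_le_rpow ?_ hp0
    rw [Subgroup.coe_mul, ← mul_assoc]
    exact tsum_le_returnCount hσ u (det₂_unimod hw.1.1) hε hε1 (fun x => (hf x).2) _ hb
  rw [hs, Measure.restrict_smul, lintegral_smul_measure,
    setLIntegral_siegelDomain_coneMeasure hσ hFk, smul_eq_mul, mul_assoc s]
  refine mul_le_mul_right ?_ s
  set E₁ := ENNReal.ofReal (ε * R ^ p)
  set E₂ := ENNReal.ofReal (ε * R ^ 2 + (ε * R ^ 2) ^ 2)
  have hmeas : Measurable fun w : (ℝ × ℝ) × (ℝ × ℝ) => ENNReal.ofReal (‖w.1‖ ^ (-p)) := by fun_prop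
  calc _ ≤ ∫⁻ w in reducedCone, 3 ^ p * K * (E₁ * ENNReal.ofReal (‖w.1‖ ^ (-p)) + E₂) := by
        refine setLIntegral_mono' measurableSet_reducedCone fun w hw => ?_
        exact (lintegral_mono fun u => hpt w hw u).trans
          (lintegral_toTorus_returnCount_le hp1 hK hw hR hε)
    _ = 3 ^ p * K * (E₁ * Iₚ + E₂ * I₀) := by
        rw [lintegral_const_mul _ ((hmeas.const_mul _).add_const _),
          lintegral_add_right _ measurable_const, lintegral_const_mul _ hmeas, setLIntegral_const]
    _ ≤ _ := by
        rw [mul_assoc (3 ^ p * K)]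
        refine mul_le_mul_right ?_ _
        rw [add_mul, mul_add, mul_add, mul_comm E₁, mul_comm E₂]
        exact add_le_add le_self_add le_add_self

/-! ### Renormalization by diagonal matrices -/

lemma det₂_diag {s : ℝ} (hs : s ≠ 0) : det₂ (((s, 0), (0, s⁻¹)) : (ℝ × ℝ) × (ℝ × ℝ)) = 1 := by
  simp [det₂, hs]

lemma mulVec_fixColElt_diag (hσ : σ j = 0) {s : ℝ} (hs : s ≠ 0) (y : Fin 3 → ℝ) (i : Fin 3) :
    (fixColElt hσ ((s, 0), (0, s⁻¹)) 0 (det₂_diag hs) : fixCol j).1.1.mulVec y (σ.symm i) =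
      ![1, s, s⁻¹] i * y (σ.symm i) := by
  change ((blockMatrix ((s, 0), (0, s⁻¹)) 0).submatrix σ σ).mulVec y (σ.symm i) = _
  have hy : y = (y ∘ σ.symm) ∘ σ := by
    funext i
    simp
  conv_lhs => rw [hy]
  rw [Matrix.submatrix_mulVec_equiv]
  simp only [Function.comp_apply, Equiv.apply_symm_apply]
  fin_cases i <;> simp [blockMatrix, Matrix.mulVec, dotProduct, Fin.sum_univ_three]

/-- Since `p / 2 ≤ 1`, the growth `e^{N p / 2}` of `R ^ p` is beaten by the factor `e^{-N}` in `ε`.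
-/
lemma rpow_moment_le {c p β : ℝ} (hc0 : 0 < c) (hc1 : c < 1) (hp1 : 1 ≤ p) (hp2 : p < 2)
    (hβ : 0 < β) (N : ℕ) :
    c * Real.exp (-N) * √(c * β * Real.exp N) ^ p ≤ β ^ (p / 2) := by
  have hE : 1 ≤ Real.exp N := Real.one_le_exp (Nat.cast_nonneg N)
  have hE0 : 0 < Real.exp N := Real.exp_pos _
  rw [Real.sqrt_eq_rpow, ← Real.rpow_mul (by positivity), show 1 / 2 * p = p / 2 by ring,
    Real.mul_rpow (by positivity) hE0.le, Real.mul_rpow hc0.le hβ.le]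
  have h1 : Real.exp N ^ (p / 2) ≤ Real.exp N := by
    conv_rhs => rw [← Real.rpow_one (Real.exp N)]
    exact Real.rpow_le_rpow_of_exponent_le hE (by linarith)
  have h2 : c ^ (p / 2) ≤ 1 := Real.rpow_le_one hc0.le hc1.le (by linarith)
  have h3 : Real.exp (-N) * Real.exp N = 1 := by rw [← Real.exp_add]; simp
  have h4 : 0 < β ^ (p / 2) := Real.rpow_pos_of_pos hβ _
  calc c * Real.exp (-N) * (c ^ (p / 2) * β ^ (p / 2) * Real.exp N ^ (p / 2))
      ≤ 1 * Real.exp (-N) * (1 * β ^ (p / 2) * Real.exp N) := by gcongr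
    _ = (Real.exp (-N) * Real.exp N) * β ^ (p / 2) := by ring
    _ = β ^ (p / 2) := by rw [h3, one_mul]

lemma rpow_le_rpow_mul {β B s t : ℝ} (hβ : 0 < β) (hB : β ≤ B) (hst : s ≤ t) :
    β ^ t ≤ B ^ (t - s) * β ^ s := by
  calc β ^ t = β ^ (t - s) * β ^ s := by rw [← Real.rpow_add hβ, sub_add_cancel]
    _ ≤ _ := by gcongr

/-- The moment bound for either of the two stabilizers. -/
lemma exists_siegel_moment_le (hσ : σ j = 0) {c p B : ℝ} (hc0 : 0 < c) (hc1 : c < 1)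
    (hp1 : 1 ≤ p) (hp2 : p < 2) :
    ∃ C : ℝ, 0 < C ∧ ∀ β : ℝ, 0 < β → β ≤ B →
      ∀ f : (Fin 3 → ℝ) → ℝ, Measurable f → (∀ x, 0 ≤ f x ∧ f x ≤ 1) →
      (∀ x, f x ≠ 0 → |x (σ.symm 0)| ≤ c ∧ |x (σ.symm 1)| ≤ c ∧ |x (σ.symm 2)| ≤ β) →
      ∀ (b : SL(3, ℝ)) (N N' : ℕ),
      (∀ (y : Fin 3 → ℝ) (i : Fin 3), b.1.mulVec y (σ.symm i) =
        ![Real.exp N, Real.exp N', Real.exp (-N - N')] i * y (σ.symm i)) →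
      IntegrableOn (fun y => siegel f (b • y) ^ p) (homSubspace Gam (fixCol j))
          (homMeasure Gam (fixCol j)) ∧
        ∫ y in homSubspace Gam (fixCol j), siegel f (b • y) ^ p ∂homMeasure Gam (fixCol j) ≤
          C * β ^ (p / 2) := by
  obtain ⟨C, hCtop, hC⟩ := exists_lintegral_siegel_le hσ hp1 hp2
  set Q := quotientMeasure Gam (fixCol j) Measure.haar with hQ
  obtain ⟨D, hDtop, hD⟩ : ∃ D : ℝ≥0∞, D ≠ ∞ ∧ ∀ (F : X → ℝ≥0∞) (E : ℝ≥0∞),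
      ∫⁻ y, F y ∂Q ≤ C * E → ∫⁻ y, F y ∂homMeasure Gam (fixCol j) ≤ D * E := by
    -- Only finiteness of `(Q univ)⁻¹` matters: it fails just for `Q = 0`, where the integral
    -- vanishes, while infinite total mass would give the harmless factor zero.
    by_cases h0 : Q univ = 0
    · refine ⟨0, by simp, fun F E _ => ?_⟩
      rw [homMeasure, ← hQ, Measure.measure_univ_eq_zero.1 h0, smul_zero, lintegral_zero_measure]
      exact zero_le
    · refine ⟨(Q univ)⁻¹ * C, ENNReal.mul_ne_top (ENNReal.inv_ne_top.2 h0) hCtop,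
        fun F E hFE => ?_⟩
      rw [homMeasure, ← hQ, lintegral_smul_measure, smul_eq_mul, mul_assoc]
      gcongr
  set M := 1 + (B ^ (1 - p / 2) + B ^ (2 - p / 2))
  -- The sign of `B` is known only once some `β` is given, hence the absolute value; `+ 1` makes the
  -- constant positive.
  refine ⟨D.toReal * |M| + 1, by positivity, ?_⟩
  intro β hβ hβB f hfm hf hsupp b N N' hb
  have hB : 0 < B := hβ.trans_le hβB
  have hM : 0 ≤ M := by positivity
  rw [abs_of_nonneg hM]
  have hEN : 0 < Real.exp N := Real.exp_pos _
  have hexp : Real.exp (-N) * Real.exp N = 1 := by rw [← Real.exp_add]; simp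
  -- `R²` is the product of the half-sides `c e^{-N'}` and `β e^{N + N'}`; the diagonal entries `s`,
  -- `s⁻¹` below turn both of them into `R`.
  set R := √(c * β * Real.exp N)
  have hR : 0 < R := Real.sqrt_pos.2 (by positivity)
  have hR2 : R ^ 2 = c * β * Real.exp N := Real.sq_sqrt (by positivity)
  set ε := c * Real.exp (-N)
  have hε : 0 ≤ ε := by positivity
  have hε1 : ε < 1 := by
    have : Real.exp (-N) ≤ 1 := Real.exp_le_one_iff.2 (by simp)
    nlinarith
  set s := c * Real.exp (-N') / R
  have hs : 0 < s := by positivity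
  have hbox : ∀ z : Fin 3 → ℤ, ∀ h : SL(3, ℝ),
      f (latPoint (b * (fixColElt hσ ((s, 0), (0, s⁻¹)) 0 (det₂_diag hs.ne') : fixCol j) * h) z) ≠ 0
      → |latPoint h z (σ.symm 0)| ≤ ε ∧ |latPoint h z (σ.symm 1)| ≤ R ∧
        |latPoint h z (σ.symm 2)| ≤ R := by
    intro z h hne
    have hmul : latPoint
        (b * (fixColElt hσ ((s, 0), (0, s⁻¹)) 0 (det₂_diag hs.ne') : fixCol j) * h) z =
        b.1.mulVec ((fixColElt hσ ((s, 0), (0, s⁻¹)) 0 (det₂_diag hs.ne') : fixCol j).1.1.mulVec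
          (latPoint h z)) := by
      rw [latPoint, latPoint, Matrix.mulVec_mulVec, Matrix.mulVec_mulVec]
      rfl
    obtain ⟨h0, h1, h2⟩ := hsupp _ hne
    rw [hmul, hb, mulVec_fixColElt_diag hσ hs.ne'] at h0 h1 h2
    simp only [Matrix.cons_val, abs_mul, Real.abs_exp, one_mul, abs_of_pos hs,
      abs_of_pos (inv_pos.2 hs)] at h0 h1 h2
    have hEN' : Real.exp N' * Real.exp (-N') = 1 := by rw [← Real.exp_add]; simp
    refine ⟨?_, ?_, ?_⟩
    · calc |latPoint h z (σ.symm 0)|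
          = Real.exp (-N) * (Real.exp N * |latPoint h z (σ.symm 0)|) := by
            rw [← mul_assoc, hexp, one_mul]
        _ ≤ Real.exp (-N) * c := by gcongr
        _ = ε := mul_comm _ _
    · have : Real.exp N' * s = c / R := by
        simp only [s]
        rw [mul_div_assoc', mul_left_comm, hEN', mul_one]
      rw [← mul_assoc, this, div_mul_eq_mul_div, div_le_iff₀ hR] at h1
      exact le_of_mul_le_mul_left h1 hc0
    · have h3 : Real.exp (-N - N') * s⁻¹ = R / (c * Real.exp N) := by
        simp only [s]
        rw [sub_eq_add_neg, Real.exp_add, Real.exp_neg N]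
        field_simp
      rw [← mul_assoc, h3, div_mul_eq_mul_div, div_le_iff₀ (by positivity),
        show β * (c * Real.exp N) = R * R by rw [← sq, hR2]; ring] at h2
      exact le_of_mul_le_mul_left h2 hR
  -- The factors `e^{±N}` cancel, which makes the bound uniform in `n`.
  have hX : ε * R ^ 2 = c ^ 2 * β := by
    rw [hR2]
    linear_combination c ^ 2 * β * hexp
  have hmain := hD _ _ (hC R ε hR.le hε hε1 f hfm hf b _ hbox)
  have hbound : ENNReal.ofReal (ε * R ^ p) + ENNReal.ofReal (ε * R ^ 2 + (ε * R ^ 2) ^ 2) ≤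
      ENNReal.ofReal (M * β ^ (p / 2)) := by
    rw [← ENNReal.ofReal_add (by positivity) (by positivity)]
    refine ENNReal.ofReal_le_ofReal ?_
    have h1 := rpow_moment_le hc0 hc1 hp1 hp2 hβ N
    have h2 := rpow_le_rpow_mul (t := 1) hβ hβB (show p / 2 ≤ 1 by linarith)
    have h3 := rpow_le_rpow_mul (t := 2) hβ hβB (show p / 2 ≤ 2 by linarith)
    rw [Real.rpow_one] at h2
    rw [Real.rpow_two] at h3
    have hX1 : ε * R ^ 2 ≤ β := by
      rw [hX]
      exact mul_le_of_le_one_left hβ.le (pow_le_one₀ hc0.le hc1.le)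
    have hX2 : (ε * R ^ 2) ^ 2 ≤ β ^ 2 := by gcongr
    calc ε * R ^ p + (ε * R ^ 2 + (ε * R ^ 2) ^ 2)
        ≤ β ^ (p / 2) + (B ^ (1 - p / 2) * β ^ (p / 2) + B ^ (2 - p / 2) * β ^ (p / 2)) := by
          exact add_le_add h1 (add_le_add (hX1.trans h2) (hX2.trans h3))
      _ = M * β ^ (p / 2) := by
          simp only [M]
          ring
  have hlin : ∫⁻ y in homSubspace Gam (fixCol j), ENNReal.ofReal (siegel f (b • y) ^ p)
      ∂homMeasure Gam (fixCol j) ≤ D * ENNReal.ofReal (M * β ^ (p / 2)) := by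
    refine (lintegral_mono' Measure.restrict_le_self le_rfl).trans (hmain.trans ?_)
    gcongr
  have hfin : D * ENNReal.ofReal (M * β ^ (p / 2)) ≠ ∞ :=
    ENNReal.mul_ne_top hDtop ENNReal.ofReal_ne_top
  have hnn : ∀ y : X, 0 ≤ siegel f (b • y) ^ p := fun y =>
    Real.rpow_nonneg (siegel_nonneg (fun x => (hf x).1) _) _
  have hmeas : AEStronglyMeasurable (fun y : X => siegel f (b • y) ^ p)
      ((homMeasure Gam (fixCol j)).restrict (homSubspace Gam (fixCol j))) :=
    ((measurable_siegel hfm (fun x => (hf x).1) b).pow_const p).aestronglyMeasurable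
  refine ⟨⟨hmeas, ?_⟩, ?_⟩
  · rw [hasFiniteIntegral_iff_ofReal (Filter.Eventually.of_forall hnn)]
    exact lt_of_le_of_lt hlin hfin.lt_top
  · rw [integral_eq_lintegral_of_nonneg_ae (Filter.Eventually.of_forall hnn) hmeas]
    refine (ENNReal.toReal_mono hfin hlin).trans ?_
    rw [ENNReal.toReal_mul, ENNReal.toReal_ofReal (by positivity), ← mul_assoc, add_mul, one_mul]
    exact le_add_of_nonneg_right (by positivity)

lemma mulVec_a (t₁ t₂ : ℝ) (y : Fin 3 → ℝ) (i : Fin 3) : (a t₁ t₂).1.mulVec y i =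
    ![Real.exp t₁, Real.exp t₂, Real.exp (-t₁ - t₂)] i * y i :=
  Matrix.mulVec_diagonal _ _ _

end LatticeSpace

theorem mainTheorem6 (c p B : ℝ) (hc0 : 0 < c) (hc1 : c < 1) (hp1 : 1 ≤ p) (hp2 : p < 2)
    (hB : 0 < B) :
    ∃ C : ℝ, 0 < C ∧
      ∀ β : ℝ, 0 < β → β ≤ B →
      ∀ f : (Fin 3 → ℝ) → ℝ, Measurable f → (∀ x, 0 ≤ f x ∧ f x ≤ 1) →
        (Function.support f ⊆ {x | |x 0| ≤ c ∧ |x 1| ≤ c ∧ |x 2| ≤ β}) →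
      ∀ n₁ n₂ : ℕ,
        (MeasureTheory.IntegrableOn
            (fun y => LatticeSpace.siegel f (LatticeSpace.a n₁ n₂ • y) ^ p)
            LatticeSpace.Y₁ LatticeSpace.ν₁ ∧
          ∫ y in LatticeSpace.Y₁, LatticeSpace.siegel f (LatticeSpace.a n₁ n₂ • y) ^ p
            ∂LatticeSpace.ν₁ ≤ C * β ^ (p / 2)) ∧
        (MeasureTheory.IntegrableOn
            (fun y => LatticeSpace.siegel f (LatticeSpace.a n₁ n₂ • y) ^ p)
            LatticeSpace.Y₂ LatticeSpace.ν₂ ∧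
          ∫ y in LatticeSpace.Y₂, LatticeSpace.siegel f (LatticeSpace.a n₁ n₂ • y) ^ p
            ∂LatticeSpace.ν₂ ≤ C * β ^ (p / 2)) := by
  -- For `G₁` the first two coordinates trade places: the box is symmetric in them, and `n₂` takes
  -- the role of the exponent `N` in the fixed direction.
  obtain ⟨C₁, hC₁, h₁⟩ := LatticeSpace.exists_siegel_moment_le (σ := Equiv.swap 0 1) (j := 1)
    (Equiv.swap_apply_right 0 1) (B := B) hc0 hc1 hp1 hp2
  obtain ⟨C₂, hC₂, h₂⟩ := LatticeSpace.exists_siegel_moment_le (σ := Equiv.refl _) (j := 0)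
    rfl (B := B) hc0 hc1 hp1 hp2
  refine ⟨max C₁ C₂, lt_max_of_lt_left hC₁, fun β hβ hβB f hfm hf hsupp n₁ n₂ => ?_⟩
  have e2 : Equiv.swap (0 : Fin 3) 1 2 = 2 := by decide
  obtain ⟨i₁, b₁⟩ := h₁ β hβ hβB f hfm hf (fun x hx => by
      have h := hsupp hx
      simp only [Equiv.symm_swap, Equiv.swap_apply_left, Equiv.swap_apply_right, e2]
      exact ⟨h.2.1, h.1, h.2.2⟩) (LatticeSpace.a n₁ n₂) n₂ n₁ (fun y i => by
      rw [LatticeSpace.mulVec_a]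
      congr 1
      fin_cases i <;>
        simp [Equiv.swap_apply_left, Equiv.swap_apply_right, e2]
      ring)
  obtain ⟨i₂, b₂⟩ := h₂ β hβ hβB f hfm hf (fun x hx => hsupp hx) (LatticeSpace.a n₁ n₂) n₁ n₂
    (fun y i => LatticeSpace.mulVec_a _ _ y i)
  have hβp : 0 ≤ β ^ (p / 2) := Real.rpow_nonneg hβ.le _
  exact ⟨⟨i₁, b₁.trans (mul_le_mul_of_nonneg_right (le_max_left _ _) hβp)⟩,
    ⟨i₂, b₂.trans (mul_le_mul_of_nonneg_right (le_max_right _ _) hβp)⟩⟩
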